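/- In Submodular Welfare with $k$ identical players, an instance consists of a set $\mathcal N$ of $n$ items and one non-negative submodular utility function $f\colon 2^{\mathcal N}\to\mathbb R_{\ge 0}$ (i.e. $f(A\cup B)+f(A\cap B)\le f(A)+f(B)$ for all $A,B\subseteq\mathcal N$), accessible through a value oracle that returns $f(S)$ on query $S$. A solution is a partition $(S_1,\dots,S_k)$ of $\mathcal N$ into $k$ (possibly empty) parts, its welfare is $\sum_{i=1}^k f(S_i)$, and $\mathrm{OPT}$ is the maximum welfare. A randomized algorithm has approximation ratio $r$ for $n$ items if on every instance with $n$ items its expected welfare is at least $r\cdot\mathrm{OPT}$. (a) The algorithm that assigns each item independently to a uniformly random one of the $k$ players can be implemented by a single program of a random access machine (with value oracle and uniform random source, unit-cost instructions), the same for all $n\ge 0$ and $k\ge 1$, that halts within $C(n+1)$ steps for an absolute constant $C$; and it has approximation ratio $1-(1-1/k)^{k-1}$ (read as $0$ for $k=1$). (b) Conversely, for every $k\ge 2$ and every $\varepsilon>0$ there are $c>0$ and $n_0$ such that for every $n\ge n_0$ the following holds: every randomized value-oracle algorithm (with unbounded computational power) that has approximation ratio $1-(1-1/k)^{k-1}+\varepsilon$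 for $n$ items and $k$ identical players makes, on some instance with $n$ items, at least $e^{cn}$ value oracle queries in expectation. In particular, its worst-case number of queries is at least $e^{cn}$. -/

import Mathlib

namespace SubmodularWelfare

noncomputable section

/-! ### The problem -/

/-- Non-negative submodular set functions on the ground set `Fin n`. -/
structure IsUtility {n : ℕ} (f : Finset (Fin n) → ℝ) : Prop where
  nonneg : ∀ S, 0 ≤ f S
  submodular : ∀ A B, f (A ∪ B) + f (A ∩ B) ≤ f A + f B

/-- An allocation of `n` items to `k` players; player `i` gets the part `{u | a u = i}`.
These are the ordered partitions of the items into `k` (possibly empty) parts. -/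
abbrev Allocation (n k : ℕ) : Type := Fin n → Fin k

/-- The set of items that an allocation gives to player `i`. -/
def part {n k : ℕ} (a : Allocation n k) (i : Fin k) : Finset (Fin n) :=
  Finset.univ.filter fun u => a u = i

/-- The welfare of an allocation when all players have the utility function `f`. -/
def welfare {n k : ℕ} (f : Finset (Fin n) → ℝ) (a : Allocation n k) : ℝ :=
  ∑ i : Fin k, f (part a i)

/-- The value of an optimal solution for `k` players with common utility function `f`. -/
def opt {n : ℕ} (k : ℕ) (f : Finset (Fin n) → ℝ) : ℝ :=
  ⨆ a : Allocation n k, welfare f a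

/-! ### Randomized algorithms with a value oracle -/

/-- What an algorithm does next: stop with a solution, ask the value oracle for the value of a
set (and continue depending on the answer), or make a (possibly random) internal step. -/
inductive Action (n k : ℕ) (σ : Type) : Type
  | output (a : Allocation n k) : Action n k σ
  | query (S : Finset (Fin n)) (next : ℝ → σ) : Action n k σ
  | internal (p : PMF σ) : Action n k σ

/-- A randomized algorithm with value oracle access, for instances with `n` items and `k`
players. There is no restriction on its state space or on its internal computations; the utility
function is accessible only through queries. -/
structure OracleAlgorithm (n k : ℕ) : Type 1 where
  State : Type
  start : State
  act : State → Action n k State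

namespace OracleAlgorithm

variable {n k : ℕ} (A : OracleAlgorithm n k)

/-- The law of the result of `t` steps from a given state: `some a` if the algorithm stopped
with the solution `a` within these steps, `none` if it has not stopped yet. -/
def run (f : Finset (Fin n) → ℝ) : ℕ → A.State → PMF (Option (Allocation n k))
  | 0, _ => PMF.pure none
  | t + 1, s =>
    match A.act s with
    | .output a => PMF.pure (some a)
    | .query S next => run f t (next (f S))
    | .internal p => p.bind fun s' => run f t s'

/-- With probability one, the algorithm stops with a solution within `t` steps. -/
def HaltsWithin (f : Finset (Fin n) → ℝ) (t : ℕ) : Prop :=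
  A.run f t A.start none = 0

/-- The probability that the algorithm ever stops with the solution `a`. -/
def outputProb (f : Finset (Fin n) → ℝ) (a : Allocation n k) : ENNReal :=
  ⨆ t : ℕ, A.run f t A.start (some a)

/-- The expected welfare of the solution produced (no solution counts as welfare `0`). -/
def expectedWelfare (f : Finset (Fin n) → ℝ) : ℝ :=
  ∑ a : Allocation n k, (A.outputProb f a).toReal * welfare f a

/-- The expected number of oracle queries among the first `t` steps from a given state. -/
def expectedQueriesWithin (f : Finset (Fin n) → ℝ) : ℕ → A.State → ENNReal
  | 0, _ => 0
  | t + 1, s =>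
    match A.act s with
    | .output _ => 0
    | .query S next => 1 + expectedQueriesWithin f t (next (f S))
    | .internal p => ∑' s', p s' * expectedQueriesWithin f t s'

/-- The expected total number of oracle queries on the input `f`. -/
def expectedQueries (f : Finset (Fin n) → ℝ) : ENNReal :=
  ⨆ t : ℕ, A.expectedQueriesWithin f t A.start

/-- The algorithm has approximation ratio (at least) `r`: on every instance its expected welfare
is at least `r` times the optimal value. -/
def HasRatio (r : ℝ) : Prop :=
  ∀ f : Finset (Fin n) → ℝ, IsUtility f → r * opt k f ≤ A.expectedWelfare f

end OracleAlgorithm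

/-! ### Random access machines with a value oracle -/

/-- Instructions of a random access machine with an integer memory `M`, a real memory `R` for
oracle answers, a uniform random source, and a value oracle. Each takes one time unit. -/
inductive Instr : Type
  /-- `M[d] := v` -/
  | const (d v : ℕ)
  /-- `M[d] := M[a] + M[b]` -/
  | add (d a b : ℕ)
  /-- `M[d] := M[a] - M[b]`, truncated at `0` -/
  | sub (d a b : ℕ)
  /-- `M[d] := M[M[a]]` -/
  | load (d a : ℕ)
  /-- `M[M[d]] := M[a]` -/
  | store (d a : ℕ)
  /-- continue at instruction `l` if `M[a] < M[b]` -/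
  | jumpLt (a b l : ℕ)
  /-- `M[d] :=` a uniformly random element of `{0, …, M[a] - 1}` (`0` if `M[a] = 0`) -/
  | rand (d a : ℕ)
  /-- `R[d] :=` the value of the set of all items `u` with `M[M[a] + u] ≠ 0` -/
  | query (d a : ℕ)
  /-- `R[d] := R[a] + R[b]` -/
  | addR (d a b : ℕ)
  /-- `R[d] := R[a] - R[b]` -/
  | subR (d a b : ℕ)
  /-- continue at instruction `l` if `R[a] < R[b]` -/
  | jumpLtR (a b l : ℕ)

/-- A program: one fixed finite list of instructions, used for all inputs. -/
abbrev Program : Type := List Instr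

/-- Configurations: program counter, integer memory, real memory. -/
structure Config : Type where
  pc : ℕ
  M : ℕ → ℕ
  R : ℕ → ℝ

namespace Config

/-- Go to the next instruction. -/
def next (c : Config) : Config := { c with pc := c.pc + 1 }

/-- Write `v` to `M[d]` and go to the next instruction. -/
def write (c : Config) (d v : ℕ) : Config :=
  { c with pc := c.pc + 1, M := Function.update c.M d v }

/-- Write `x` to `R[d]` and go to the next instruction. -/
def writeR (c : Config) (d : ℕ) (x : ℝ) : Config :=
  { c with pc := c.pc + 1, R := Function.update c.R d x }

/-- Go to instruction `l`. -/
def goto (c : Config) (l : ℕ) : Config := { c with pc := l }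

end Config

/-- The uniform distribution on `{0, …, m - 1}` (the point mass at `0` if `m = 0`). -/
def uniformBelow : ℕ → PMF ℕ
  | 0 => PMF.pure 0
  | m + 1 => PMF.uniformOfFinset (Finset.range (m + 1)) ⟨0, by simp⟩

open Classical in
/-- Effect of one instruction. -/
def Instr.act (n k : ℕ) (c : Config) : Instr → Action n k Config
  | .const d v => .internal (PMF.pure (c.write d v))
  | .add d a b => .internal (PMF.pure (c.write d (c.M a + c.M b)))
  | .sub d a b => .internal (PMF.pure (c.write d (c.M a - c.M b)))
  | .load d a => .internal (PMF.pure (c.write d (c.M (c.M a))))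
  | .store d a => .internal (PMF.pure (c.write (c.M d) (c.M a)))
  | .jumpLt a b l => .internal (PMF.pure (if c.M a < c.M b then c.goto l else c.next))
  | .rand d a => .internal ((uniformBelow (c.M a)).map fun v => c.write d v)
  | .query d a =>
      .query (Finset.univ.filter fun u : Fin n => c.M (c.M a + u) ≠ 0) fun x => c.writeR d x
  | .addR d a b => .internal (PMF.pure (c.writeR d (c.R a + c.R b)))
  | .subR d a b => .internal (PMF.pure (c.writeR d (c.R a - c.R b)))
  | .jumpLtR a b l => .internal (PMF.pure (if c.R a < c.R b then c.goto l else c.next))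

/-- The memory cell from which on the solution is read off. -/
def outputBase : ℕ := 8

/-- The algorithm computed by a program. At the start `M[0] = n`, `M[1] = k`, and all other
cells are `0`. The machine stops when the program counter leaves the program; then item `u`
goes to player `M[outputBase + u]`. If that is not the number of a player for some `u`, the
machine produces no solution (it idles forever). -/
def Program.algorithm (P : Program) (n k : ℕ) : OracleAlgorithm n k where
  State := Config
  start := { pc := 0, M := fun j => if j = 0 then n else if j = 1 then k else 0, R := fun _ => 0 }
  act c :=
    match P[c.pc]? with
    | some I => I.act n k c
    | none =>
      if h : ∀ u : Fin n, c.M (outputBase + u) < k then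
        .output fun u => ⟨c.M (outputBase + u), h u⟩
      else .internal (PMF.pure c)

end

end SubmodularWelfare

open SubmodularWelfare

/-! (a) Under the uniform assignment each part is a random set `R` containing every item
independently with probability `p = 1/k`, so the expected welfare is `k · E f(R)`. Fix an optimal
partition `O` and let `g I` be the value of the union of the parts indexed by `I`. Sampling whole
parts instead of items cannot increase the expectation (`IsSubmodular.sampled_groups_le`), so `k · E
g(I)` for a random set `I` of players is a lower bound. Averaging `g` over all permutations makes it
a function of `#I` that is concave and non-negative, hence at least the chord from `(1, g(1))` to
`(k, 0)` (`symmetrized_ge`). Integrating the chord against the binomial law gives the ratio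
(`sampled_ge_sum_singleton`).

(b) A uniformly random coloring `c` of the items with `k` colors is hidden. In terms of the
complement `T` of a queried set, `symmetric` is `m - m ^ k`, where `m` is the proportion of items in
`T`, and `hidden` replaces `m ^ k` by the product of the proportions of the `k` colors inside `T`,
up to a perturbation of size `η`. The perturbation makes the two functions equal on every set in
which the colors are nearly equally frequent (`hidden_eq_symmetric`). The color classes themselves
have welfare close to `k - 1` under `hidden`, since each complement misses a color, whereas by
convexity no allocation has more than about `(k - 1) * (1 - (1 - 1/k) ^ (k - 1))` under `symmetric`.

Submodularity of `hidden` amounts to monotone increments of `cutProd`. It is the maximum of a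
product under a budget constraint, so its slope in direction `i` is the product of the other cut
coordinates, which is monotone (`Cuttable.cutProd_increment_mono`). By a Chernoff bound a fixed set
is unbalanced for an exponentially small fraction of the colorings (`card_not_balanced_le`). An
algorithm run on `symmetric` therefore rarely meets a set that separates the two functions;
averaging over colorings (`sum_expectedWelfare_le`) bounds the number of queries from below. -/

namespace SubmodularWelfare
noncomputable section
open scoped ENNReal

/-! ### Runs of the random assignment program and the law of its output. -/

namespace OracleAlgorithm

variable {n k : ℕ} (A : OracleAlgorithm n k) (f : Finset (Fin n) → ℝ)

variable {A} in
theorem run_internal {s : A.State} {p : PMF A.State} (h : A.act s = .internal p) (t : ℕ) :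
    A.run f (t + 1) s = p.bind fun s' => A.run f t s' := by
  rw [run, h]

variable {A} in
theorem run_query {s : A.State} {S : Finset (Fin n)} {next : ℝ → A.State}
    (h : A.act s = .query S next) (t : ℕ) : A.run f (t + 1) s = A.run f t (next (f S)) := by
  rw [run, h]

variable {A} in
theorem run_output {s : A.State} {a : Allocation n k} (h : A.act s = .output a) (t : ℕ) :
    A.run f (t + 1) s = PMF.pure (some a) := by
  rw [run, h]

theorem run_some_le_succ (a : Allocation n k) (t : ℕ) (s : A.State) :
    A.run f t s (some a) ≤ A.run f (t + 1) s (some a) := by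
  induction t generalizing s with
  | zero => simp [run]
  | succ t ih =>
    cases h : A.act s with
    | output b => rw [run_output f h, run_output f h]
    | query S next => rw [run_query f h, run_query f h]; exact ih _
    | internal p =>
      rw [run_internal f h, run_internal f h, PMF.bind_apply, PMF.bind_apply]
      exact ENNReal.tsum_le_tsum fun s' => mul_le_mul_right (ih s') _

theorem run_some_mono (a : Allocation n k) (s : A.State) :
    Monotone fun t => A.run f t s (some a) :=
  monotone_nat_of_le_succ fun t => A.run_some_le_succ f a t s

end OracleAlgorithm

theorem uniformBelow_apply {m v : ℕ} (h : v < m) : uniformBelow m v = (m : ℝ≥0∞)⁻¹ := by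
  cases m with
  | zero => omega
  | succ m =>
    have := PMF.uniformOfFinset_apply_of_mem ⟨0, by simp⟩ (Finset.mem_range.2 h)
    rw [Finset.card_range] at this
    exact this

theorem uniformBelow_apply_of_le {m v : ℕ} (hm : 1 ≤ m) (h : m ≤ v) : uniformBelow m v = 0 := by
  cases m with
  | zero => omega
  | succ m =>
    exact PMF.uniformOfFinset_apply_of_notMem ⟨0, by simp⟩ (by simpa using h)

/-- The program that gives every item to a uniformly random player. -/
def randomProgram : Program :=
  [.const 2 8, .const 4 1, .add 3 0 2, .jumpLt 4 3 7, .rand 6 1, .store 2 6, .add 2 2 4,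
    .jumpLt 2 3 4]

/-- The configurations at the loop test of `randomProgram`, after `j` items are assigned. -/
structure AtLoopTest (n k j : ℕ) (c : Config) : Prop where
  pc : c.pc = 7
  players : c.M 1 = k
  pointer : c.M 2 = 8 + j
  bound : c.M 3 = 8 + n
  one : c.M 4 = 1
  assigned : ∀ u < j, c.M (8 + u) < k

/-- The configuration after one more round of the loop, in which the player `v` was drawn. -/
def roundResult (c : Config) (v : ℕ) : Config :=
  { pc := 7
    M := Function.update (Function.update (Function.update c.M 6 v) (c.M 2) v) 2 (c.M 2 + 1)
    R := c.R }

variable {n k : ℕ}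

theorem AtLoopTest.roundResult {j v : ℕ} {c : Config} (h : AtLoopTest n k j c) (hv : v < k) :
    AtLoopTest n k (j + 1) (roundResult c v) := by
  obtain ⟨h0, h1, h2, h3, h4, h5⟩ := h
  refine ⟨rfl, ?_, ?_, ?_, ?_, ?_⟩
  · simp [SubmodularWelfare.roundResult, h1, h2, Function.update_apply]; omega
  · simp [SubmodularWelfare.roundResult, h2]; omega
  · simp [SubmodularWelfare.roundResult, h3, h2, Function.update_apply]; omega
  · simp [SubmodularWelfare.roundResult, h4, h2, Function.update_apply]; omega
  · intro u hu
    have e1 : 8 + u ≠ 2 := by omega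
    have e2 : 8 + u ≠ 6 := by omega
    simp only [SubmodularWelfare.roundResult, h2, Function.update_apply, e1, e2, if_false]
    split_ifs with e
    · exact hv
    · exact h5 u (by omega)

theorem roundResult_cell {j v u : ℕ} {c : Config} (h : AtLoopTest n k j c) :
    (roundResult c v).M (8 + u) = if u = j then v else c.M (8 + u) := by
  have e1 : 8 + u ≠ 2 := by omega
  have e2 : 8 + u ≠ 6 := by omega
  simp only [roundResult, h.pointer, Function.update_apply, e1, e2, if_false,
    Nat.add_left_cancel_iff]

theorem run_step {P : Program} (f : Finset (Fin n) → ℝ) (t : ℕ) {c c' : Config} {I : Instr}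
    (hI : P[c.pc]? = some I) (hc : I.act n k c = .internal (PMF.pure c')) :
    (P.algorithm n k).run f (t + 1) c = (P.algorithm n k).run f t c' := by
  have e : (P.algorithm n k).act c = .internal (PMF.pure c') := by
    simp only [Program.algorithm, hI, hc]
  exact (OracleAlgorithm.run_internal f e t).trans (PMF.pure_bind _ _)

theorem run_round (f : Finset (Fin n) → ℝ) {j t : ℕ} {c : Config} (h : AtLoopTest n k j c)
    (hj : j < n) :
    (randomProgram.algorithm n k).run f (t + 4) c =
      (uniformBelow k).bind fun v =>
        (randomProgram.algorithm n k).run f t (roundResult c v) := by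
  obtain ⟨pc, M, R⟩ := c
  obtain ⟨h0, h1, h2, h3, h4, h5⟩ := h
  simp only at h0 h1 h2 h3 h4 h5
  subst h0
  rw [run_step (c' := ⟨4, M, R⟩) f (t + 3) (I := .jumpLt 2 3 4) rfl]
  · have e : (randomProgram.algorithm n k).act ⟨4, M, R⟩ =
        .internal ((uniformBelow k).map fun v => ⟨5, Function.update M 6 v, R⟩) := by
      rw [← h1]; rfl
    refine (OracleAlgorithm.run_internal f e _).trans ((PMF.bind_map _ _ _).trans ?_)
    congr 1
    funext v
    change (randomProgram.algorithm n k).run f (t + 2) ⟨5, Function.update M 6 v, R⟩ = _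
    rw [run_step (c' := ⟨6, Function.update (Function.update M 6 v) (8 + j) v, R⟩) f (t + 1)
      (I := .store 2 6) rfl, run_step f t (I := .add 2 2 4) rfl rfl]
    · simp only [Config.write, roundResult, h2]
      rw [Function.update_of_ne (a := 4) (by omega), Function.update_of_ne (a := 4) (by omega), h4,
        Function.update_of_ne (a := 2) (by omega), Function.update_of_ne (a := 2) (by omega), h2]
    · simp only [Instr.act, Config.write]
      rw [Function.update_of_ne (a := 2) (by omega), h2, Function.update_self]
  · simp only [Instr.act, Config.goto, h2, h3, Nat.add_lt_add_iff_left, hj, if_true]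

theorem run_finish (f : Finset (Fin n) → ℝ) {t : ℕ} {c : Config} (h : AtLoopTest n k n c)
    (a : Allocation n k) :
    (randomProgram.algorithm n k).run f (t + 2) c (some a) =
      if ∀ u : Fin n, c.M (8 + u) = a u then 1 else 0 := by
  obtain ⟨pc, M, R⟩ := c
  obtain ⟨h0, h1, h2, h3, h4, h5⟩ := h
  simp only at h0 h1 h2 h3 h4 h5
  subst h0
  have h6 : ∀ u : Fin n, M (outputBase + u) < k := fun u => h5 u u.2
  rw [run_step (c' := ⟨8, M, R⟩) f (t + 1) (I := .jumpLt 2 3 4) rfl]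
  · have e : (randomProgram.algorithm n k).act ⟨8, M, R⟩ =
        .output fun u => ⟨M (outputBase + u), h6 u⟩ := dif_pos h6
    rw [OracleAlgorithm.run_output f e]
    simp only [PMF.pure_apply, Option.some.injEq, funext_iff, Fin.ext_iff, outputBase, eq_comm]
  · simp only [Instr.act, Config.next, h2, h3, lt_irrefl, if_false]

theorem run_loop (hk : 1 ≤ k) (f : Finset (Fin n) → ℝ) (a : Allocation n k) (d : ℕ) :
    ∀ (j t : ℕ) (c : Config), AtLoopTest n k j c → j + d = n →
    (randomProgram.algorithm n k).run f (t + 2 + 4 * d) c (some a) =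
      if ∀ u : Fin n, (u : ℕ) < j → c.M (8 + u) = a u then ((k : ℝ≥0∞) ^ d)⁻¹ else 0 := by
  induction d with
  | zero =>
    intro j t c h hj
    obtain rfl : j = n := by omega
    rw [mul_zero, add_zero, run_finish f h]
    simp
  | succ d ih =>
    intro j t c h hj
    have hjn : j < n := by omega
    rw [show t + 2 + 4 * (d + 1) = (t + 2 + 4 * d) + 4 by ring, run_round f h hjn,
      -- Cell `8 + j` is not written again, so only the draw `a j` can still lead to the output `a`.
      PMF.bind_apply, tsum_eq_single (a ⟨j, hjn⟩ : ℕ), uniformBelow_apply (a ⟨j, hjn⟩).2,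
      ih (j + 1) t _ (h.roundResult (a ⟨j, hjn⟩).2) (by omega)]
    · have e : (∀ u : Fin n, (u : ℕ) < j + 1 →
          (roundResult c (a ⟨j, hjn⟩)).M (8 + u) = a u) ↔
          ∀ u : Fin n, (u : ℕ) < j → c.M (8 + u) = a u := by
        simp only [roundResult_cell h]
        constructor
        · intro H u hu
          have := H u (by omega)
          rwa [if_neg (by omega)] at this
        · intro H u hu
          split_ifs with hu'
          · congr; exact hu'.symm
          · exact H u (by omega)
      rw [if_congr e rfl rfl]
      split_ifs
      · rw [pow_succ', ENNReal.mul_inv (by simp) (by simp)]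
      · simp
    · intro v hv
      rcases lt_or_ge v k with hvk | hvk
      · rw [ih (j + 1) t _ (h.roundResult hvk) (by omega), if_neg, mul_zero]
        intro H
        have := H ⟨j, hjn⟩ (by simp)
        rw [roundResult_cell h, if_pos rfl] at this
        exact hv this
      · rw [uniformBelow_apply_of_le hk hvk, zero_mul]

/-- Four steps of set-up, four per item, and two for the last test and the output; the slack `t`
covers all later times. -/
theorem run_randomProgram (hk : 1 ≤ k) (f : Finset (Fin n) → ℝ) (a : Allocation n k) (t : ℕ) :
    (randomProgram.algorithm n k).run f (t + 2 + 4 * n + 4)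
      (randomProgram.algorithm n k).start (some a) = ((k : ℝ≥0∞) ^ n)⁻¹ := by
  let M : ℕ → ℕ := fun j => if j = 0 then n else if j = 1 then k else 0
  have h : (randomProgram.algorithm n k).run f (t + 2 + 4 * n + 4) ⟨0, M, fun _ => 0⟩ =
      (randomProgram.algorithm n k).run f (t + 2 + 4 * n)
        ⟨7, Function.update (Function.update (Function.update M 2 8) 4 1) 3 (n + 8),
          fun _ => 0⟩ := by
    rw [run_step f (t + 2 + 4 * n + 3) (I := .const 2 8) rfl rfl,
      run_step f (t + 2 + 4 * n + 2) (I := .const 4 1) rfl rfl,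
      run_step f (t + 2 + 4 * n + 1) (I := .add 3 0 2) rfl rfl,
      -- This jump is always taken, because `1 < n + 8`; it enters the loop at its test, which
      -- handles `n = 0`.
      run_step f (t + 2 + 4 * n) (I := .jumpLt 4 3 7) rfl
        (congrArg (fun c => Action.internal (PMF.pure c)) (if_pos ?_))]
    · simp [Config.write, Config.goto, M]
    · simp [Config.write, M]
  refine (DFunLike.congr_fun h _).trans ((run_loop hk f a n 0 t _ ?_ (by omega)).trans ?_)
  · refine ⟨rfl, ?_, ?_, ?_, ?_, by omega⟩ <;> simp [M, add_comm]
  · simp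

theorem randomProgram_outputProb (hk : 1 ≤ k) (f : Finset (Fin n) → ℝ) (a : Allocation n k) :
    (randomProgram.algorithm n k).outputProb f a = ((k : ℝ≥0∞) ^ n)⁻¹ := by
  refine le_antisymm (iSup_le fun t => ?_) ?_
  · rw [← run_randomProgram hk f a t]
    exact OracleAlgorithm.run_some_mono _ f a _ (by omega)
  · rw [← run_randomProgram hk f a 0]
    exact le_iSup (fun t => (randomProgram.algorithm n k).run f t _ (some a)) _

/-- The `k ^ n` solutions already carry total mass `1` at this time, which leaves nothing for
`none`. -/
theorem randomProgram_haltsWithin (hk : 1 ≤ k) (f : Finset (Fin n) → ℝ) :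
    (randomProgram.algorithm n k).HaltsWithin f (6 * (n + 1)) := by
  have h := ((randomProgram.algorithm n k).run f (6 * (n + 1))
    (randomProgram.algorithm n k).start).tsum_coe
  have e : ∀ a : Allocation n k, (randomProgram.algorithm n k).run f (6 * (n + 1))
      (randomProgram.algorithm n k).start (some a) = ((k : ℝ≥0∞) ^ n)⁻¹ := fun a => by
    rw [← run_randomProgram hk f a (2 * n)]; congr 2; ring
  rw [tsum_fintype, Fintype.sum_option] at h
  simp only [e, Finset.sum_const, Finset.card_univ, Fintype.card_fun, Fintype.card_fin,
    nsmul_eq_mul, Nat.cast_pow] at h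
  rw [ENNReal.mul_inv_cancel (by simp; omega) (by simp)] at h
  unfold OracleAlgorithm.HaltsWithin
  have h' : (randomProgram.algorithm n k).run f (6 * (n + 1))
      (randomProgram.algorithm n k).start none + 1 = 0 + 1 := by rw [h, zero_add]
  exact (ENNReal.add_left_inj ENNReal.one_ne_top).1 h'

theorem randomProgram_expectedWelfare (hk : 1 ≤ k) (f : Finset (Fin n) → ℝ) :
    (randomProgram.algorithm n k).expectedWelfare f =
      ((k : ℝ) ^ n)⁻¹ * ∑ a : Allocation n k, welfare f a := by
  simp [OracleAlgorithm.expectedWelfare, randomProgram_outputProb hk, Finset.mul_sum]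

end
end SubmodularWelfare

namespace SubmodularWelfare
noncomputable section
open Finset

/-! ### Expectations of submodular functions over independent random subsets. -/

section RandomSubset

variable {α : Type*}

/-- The expectation of `F T` for the random subset `T` of `s` that contains every element
independently with probability `p`. -/
def sampled (p : ℝ) (s : Finset α) (F : Finset α → ℝ) : ℝ :=
  ∑ T ∈ s.powerset, p ^ #T * (1 - p) ^ (#s - #T) * F T

theorem sampled_empty (p : ℝ) (F : Finset α → ℝ) : sampled p ∅ F = F ∅ := by
  simp [sampled]

theorem sampled_mono {p : ℝ} (h0 : 0 ≤ p) (h1 : p ≤ 1) (s : Finset α) {F G : Finset α → ℝ}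
    (h : ∀ T, F T ≤ G T) : sampled p s F ≤ sampled p s G :=
  sum_le_sum fun T _ => mul_le_mul_of_nonneg_left (h T)
    (mul_nonneg (pow_nonneg h0 _) (pow_nonneg (sub_nonneg.2 h1) _))

theorem sampled_add (p : ℝ) (s : Finset α) (F G : Finset α → ℝ) :
    sampled p s (fun T => F T + G T) = sampled p s F + sampled p s G := by
  simp only [sampled, mul_add, sum_add_distrib]

theorem sampled_const_mul (p : ℝ) (s : Finset α) (c : ℝ) (F : Finset α → ℝ) :
    sampled p s (fun T => c * F T) = c * sampled p s F := by
  simp only [sampled, mul_sum]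
  exact sum_congr rfl fun _ _ => by ring

variable [DecidableEq α]

theorem sampled_insert (p : ℝ) {s : Finset α} {x : α} (hx : x ∉ s) (F : Finset α → ℝ) :
    sampled p (insert x s) F =
      (1 - p) * sampled p s F + p * sampled p s fun T => F (insert x T) := by
  unfold sampled
  rw [sum_powerset_insert hx, mul_sum, mul_sum]
  congr 1
  · refine sum_congr rfl fun T hT => ?_
    have hc := card_le_card (mem_powerset.1 hT)
    rw [card_insert_of_notMem hx, show #s + 1 - #T = (#s - #T) + 1 by omega, pow_succ]
    ring
  · refine sum_congr rfl fun T hT => ?_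
    have hxT : x ∉ T := fun h => hx (mem_powerset.1 hT h)
    rw [card_insert_of_notMem hx, card_insert_of_notMem hxT, Nat.add_sub_add_right, pow_succ]
    ring

theorem sampled_const (p : ℝ) (s : Finset α) (c : ℝ) : sampled p s (fun _ => c) = c := by
  induction s using Finset.induction with
  | empty => exact sampled_empty p _
  | insert x s hx ih => rw [sampled_insert p hx, ih]; ring

theorem sampled_card (p : ℝ) (s : Finset α) : sampled p s (fun T => (#T : ℝ)) = p * #s := by
  induction s using Finset.induction with
  | empty => rw [sampled_empty]; simp
  | insert x s hx ih =>
    have e : sampled p s (fun T => (#(insert x T) : ℝ)) = sampled p s (fun T => (#T : ℝ) + 1) := by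
      refine sum_congr rfl fun T hT => ?_
      simp only [card_insert_of_notMem fun h => hx (mem_powerset.1 hT h), Nat.cast_succ]
    rw [sampled_insert p hx, e, sampled_add, sampled_const, ih, card_insert_of_notMem hx]
    push_cast
    ring

theorem sampled_indicator_empty (p : ℝ) (s : Finset α) :
    sampled p s (fun T => if T = ∅ then 1 else 0) = (1 - p) ^ #s := by
  unfold sampled
  rw [sum_eq_single_of_mem ∅ (empty_mem_powerset s)]
  · simp
  · intro T _ hT
    simp [hT]

theorem sampled_union (p : ℝ) {s t : Finset α} (hst : Disjoint s t) (F : Finset α → ℝ) :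
    sampled p (s ∪ t) F = sampled p s fun T => sampled p t fun T' => F (T ∪ T') := by
  induction s using Finset.induction generalizing F with
  | empty => simp [sampled_empty]
  | insert x s hx ih =>
    rw [disjoint_insert_left] at hst
    rw [insert_union, sampled_insert p (by simp [hx, hst.1]), ih hst.2, ih hst.2,
      sampled_insert p hx]
    simp only [insert_union]

/-- Submodularity of a set function. -/
def IsSubmodular (F : Finset α → ℝ) : Prop :=
  ∀ A B, F (A ∪ B) + F (A ∩ B) ≤ F A + F B

theorem IsSubmodular.union_left {F : Finset α → ℝ} (hF : IsSubmodular F) (B : Finset α) :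
    IsSubmodular fun T => F (B ∪ T) := fun S T => by
  have := hF (B ∪ S) (B ∪ T)
  rwa [← union_union_distrib_left, ← union_inter_distrib_left] at this

theorem IsSubmodular.sampled_union {F : Finset α → ℝ} (hF : IsSubmodular F) {p : ℝ} (h0 : 0 ≤ p)
    (h1 : p ≤ 1) (s : Finset α) : IsSubmodular fun S => sampled p s fun T => F (S ∪ T) := by
  intro A B
  simp only [← sampled_add]
  refine sampled_mono h0 h1 s fun T => ?_
  have := hF.union_left T A B
  simpa only [union_comm T] using this

/-- Induction on `s`, conditioning on whether `x` is sampled; the mixed term is handled by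
submodularity for `s` and `{x}`. -/
theorem IsSubmodular.le_sampled {F : Finset α → ℝ} (hF : IsSubmodular F) {p : ℝ} (h0 : 0 ≤ p)
    (h1 : p ≤ 1) (s : Finset α) : (1 - p) * F ∅ + p * F s ≤ sampled p s F := by
  induction s using Finset.induction generalizing F with
  | empty => rw [sampled_empty]; linarith
  | insert x s hx ih =>
    rw [sampled_insert p hx]
    have e1 := mul_le_mul_of_nonneg_left (ih hF) (sub_nonneg.2 h1)
    have e2 := mul_le_mul_of_nonneg_left (ih (hF.union_left {x})) h0
    simp only [singleton_union] at e2
    have e3 := hF s {x}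
    rw [union_comm, singleton_union, inter_singleton_of_notMem hx] at e3
    have e4 := mul_le_mul_of_nonneg_left e3 (mul_nonneg h0 (sub_nonneg.2 h1))
    simp only [insert_empty_eq] at e2
    nlinarith

/-- Sampling whole groups instead of single elements does not increase the expectation of a
submodular function. -/
theorem IsSubmodular.sampled_groups_le {ι : Type*} [DecidableEq ι] [Fintype α]
    {F : Finset α → ℝ} (hF : IsSubmodular F) {p : ℝ} (h0 : 0 ≤ p) (h1 : p ≤ 1) (o : α → ι)
    (J : Finset ι) :
    sampled p J (fun I => F (univ.filter fun u => o u ∈ I)) ≤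
      sampled p (univ.filter fun u => o u ∈ J) F := by
  induction J using Finset.induction generalizing F with
  | empty => simp [sampled_empty]
  | insert i J hi ih =>
    have e : ∀ I : Finset ι, (univ.filter fun u => o u ∈ insert i I) =
        (univ.filter fun u => o u = i) ∪ univ.filter fun u => o u ∈ I := fun I => by
      ext u; simp
    have hd : Disjoint (univ.filter fun u => o u = i) (univ.filter fun u => o u ∈ J) := by
      rw [disjoint_filter]
      rintro u - rfl
      exact hi
    rw [sampled_insert p hi, e, SubmodularWelfare.sampled_union p hd]
    simp only [e]
    -- After averaging over the items of the other groups, the value is still submodular in what is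
    -- taken from group `i`, so `le_sampled` replaces item-wise by all-or-nothing sampling there.
    refine le_trans ?_ ((hF.sampled_union h0 h1 _).le_sampled h0 h1 _)
    simp only [empty_union]
    exact add_le_add (mul_le_mul_of_nonneg_left (ih hF) (sub_nonneg.2 h1))
      (mul_le_mul_of_nonneg_left (ih (hF.union_left _)) h0)

end RandomSubset

/-! ### Averaging over permutations of the players. -/

section Symmetrization

variable {k : ℕ}

/-- The sum of a set function over all permutations of the ground set. -/
def symmetrized (g : Finset (Fin k) → ℝ) (I : Finset (Fin k)) : ℝ :=
  ∑ π : Equiv.Perm (Fin k), g (I.map π.toEmbedding)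

theorem symmetrized_nonneg {g : Finset (Fin k) → ℝ} (hg : ∀ I, 0 ≤ g I) (I : Finset (Fin k)) :
    0 ≤ symmetrized g I :=
  sum_nonneg fun _ _ => hg _

theorem IsSubmodular.symmetrized {g : Finset (Fin k) → ℝ} (hg : IsSubmodular g) :
    IsSubmodular (symmetrized g) := fun A B => by
  simp only [SubmodularWelfare.symmetrized, ← sum_add_distrib, map_union, map_inter]
  exact sum_le_sum fun π _ => hg _ _

theorem symmetrized_eq_of_card_eq (g : Finset (Fin k) → ℝ) {I J : Finset (Fin k)}
    (h : #I = #J) : symmetrized g I = symmetrized g J := by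
  let σ : Equiv.Perm (Fin k) := (Finset.equivOfCardEq h).extendSubtype
  have hσ : I.map σ.toEmbedding = J := by
    apply eq_of_subset_of_card_le
    · intro y hy
      obtain ⟨x, hx, rfl⟩ := mem_map.1 hy
      exact (Finset.equivOfCardEq h).extendSubtype_mem x hx
    · rw [card_map, h]
  rw [← hσ]
  refine Fintype.sum_equiv (Equiv.mulRight σ⁻¹) _ _ fun π => ?_
  rw [map_map]
  congr 2
  ext x
  simp

theorem sampled_symmetrized (p : ℝ) (g : Finset (Fin k) → ℝ) :
    sampled p univ (symmetrized g) = k.factorial * sampled p univ g := by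
  simp only [sampled, symmetrized, mul_sum]
  rw [sum_comm]
  have e : ∀ π : Equiv.Perm (Fin k), ∑ T ∈ (univ : Finset (Fin k)).powerset,
      p ^ #T * (1 - p) ^ (#(univ : Finset (Fin k)) - #T) * g (T.map π.toEmbedding) =
      ∑ T ∈ (univ : Finset (Fin k)).powerset,
        p ^ #T * (1 - p) ^ (#(univ : Finset (Fin k)) - #T) * g T := fun π => by
    rw [powerset_univ]
    refine Fintype.sum_equiv π.finsetCongr _ _ fun T => ?_
    simp
  rw [sum_congr rfl fun π _ => e π, sum_const, card_univ, Fintype.card_perm, Fintype.card_fin,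
    nsmul_eq_mul, mul_sum]

theorem sum_symmetrized_singleton (g : Finset (Fin k) → ℝ) :
    ∑ i, symmetrized g {i} = k.factorial * ∑ i, g {i} := by
  simp only [symmetrized, map_singleton]
  rw [sum_comm]
  have e : ∀ π : Equiv.Perm (Fin k), ∑ i, g {π.toEmbedding i} = ∑ i, g {i} := fun π =>
    Equiv.sum_comp π fun i => g {i}
  rw [sum_congr rfl fun π _ => e π, sum_const, card_univ, Fintype.card_perm, Fintype.card_fin,
    nsmul_eq_mul]

/-- As a function `h` of the cardinality, the symmetrization satisfies `h (j + 2) + h j ≤ 2 * h (j +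
1)`, i.e. it is concave. With `h k ≥ 0`, backward induction from the full set shows that `h j / (k -
j)` is non-decreasing for `j < k`. -/
theorem symmetrized_insert_ge {g : Finset (Fin k) → ℝ} (h0 : ∀ I, 0 ≤ g I) (hg : IsSubmodular g)
    (r : ℕ) : ∀ (I : Finset (Fin k)) (x : Fin k), x ∉ I → #Iᶜ = r + 1 →
      symmetrized g I * r ≤ symmetrized g (insert x I) * (r + 1) := by
  induction r with
  | zero => intro I x _ _; simpa using symmetrized_nonneg h0 _
  | succ r ih =>
    intro I x hx hr
    have hr' : #(insert x I)ᶜ = r + 1 := by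
      rw [compl_insert, card_erase_of_mem (by simpa using hx), hr]; rfl
    obtain ⟨y, hy⟩ : (insert x I)ᶜ.Nonempty := card_pos.1 (by omega)
    have hy' := mem_compl.1 hy
    have hyI : y ∉ I := fun h => hy' (mem_insert_of_mem h)
    have hyx : y ≠ x := fun h => hy' (h ▸ mem_insert_self x I)
    have h1 := hg.symmetrized (insert x I) (insert y I)
    have e1 : insert x I ∪ insert y I = insert y (insert x I) := by
      ext z; simp only [mem_union, mem_insert]; tauto
    have e2 : insert x I ∩ insert y I = I := by
      ext z
      simp only [mem_inter, mem_insert]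
      constructor
      · rintro ⟨rfl | h, rfl | h'⟩ <;> tauto
      · tauto
    have e3 : symmetrized g (insert y I) = symmetrized g (insert x I) :=
      symmetrized_eq_of_card_eq g (by
        rw [card_insert_of_notMem hyI, card_insert_of_notMem hx])
    rw [e1, e2, e3] at h1
    have h2 := ih (insert x I) y hy' hr'
    have h3 := mul_le_mul_of_nonneg_right h1 (by positivity : (0 : ℝ) ≤ (r : ℝ) + 1)
    push_cast
    nlinarith

theorem symmetrized_ge {g : Finset (Fin k) → ℝ} (h0 : ∀ I, 0 ≤ g I) (hg : IsSubmodular g)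
    (i : Fin k) (I : Finset (Fin k)) (hI : I.Nonempty) :
    symmetrized g {i} * (k - #I) ≤ symmetrized g I * (k - 1) := by
  induction hI using Finset.Nonempty.cons_induction with
  | singleton j => rw [symmetrized_eq_of_card_eq g (show #{i} = #{j} from rfl)]; simp
  | cons x I hx hI ih =>
    rw [cons_eq_insert]
    have hcard : #Iᶜ + #I = k := by
      rw [card_compl, Fintype.card_fin]
      have := card_le_univ I
      rw [Fintype.card_fin] at this
      omega
    obtain ⟨r, hr⟩ : ∃ r, #Iᶜ = r + 1 := by
      refine Nat.exists_eq_succ_of_ne_zero (card_pos.2 ⟨x, by simpa using hx⟩).ne'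
    have h1 := symmetrized_insert_ge h0 hg r I x hx hr
    have hk : (k : ℝ) = r + 1 + #I := by
      exact_mod_cast (hr ▸ hcard).symm
    have hI1 : (1 : ℝ) ≤ #I := by exact_mod_cast hI.card_pos
    rw [card_insert_of_notMem hx]
    push_cast
    have hr0 : (0 : ℝ) ≤ r := r.cast_nonneg
    have e1 : (k : ℝ) - #I = r + 1 := by rw [hk]; ring
    have e2 : (k : ℝ) - (#I + 1) = r := by rw [hk]; ring
    rw [e1] at ih
    rw [e2]
    have hk1 : (0 : ℝ) ≤ k - 1 := by rw [hk]; linarith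
    refine le_of_mul_le_mul_right ?_ (by positivity : (0 : ℝ) < (r : ℝ) + 1)
    have h2 := mul_le_mul_of_nonneg_right h1 hk1
    have h3 := mul_le_mul_of_nonneg_right ih hr0
    nlinarith

/-- The expected value of a random set of players that contains every player with probability
`1 / k`, compared with the values of single players. -/
theorem sampled_ge_sum_singleton (hk : 2 ≤ k) {g : Finset (Fin k) → ℝ} (h0 : ∀ I, 0 ≤ g I)
    (hg : IsSubmodular g) :
    (1 - (1 - 1 / (k : ℝ)) ^ (k - 1)) * ∑ i, g {i} ≤ k * sampled (1 / (k : ℝ)) univ g := by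
  have hk2 : (2 : ℝ) ≤ k := by exact_mod_cast hk
  have hk0 : (0 : ℝ) < k := by linarith
  set p : ℝ := 1 / k with hp
  have hp0 : 0 ≤ p := by positivity
  have hp1 : p ≤ 1 := by rw [hp, div_le_one hk0]; linarith
  have hkp : k * (1 - p) = k - 1 := by rw [hp]; field_simp
  let i₀ : Fin k := ⟨0, by omega⟩
  set c := symmetrized g {i₀} with hc
  have hsum : k * c = k.factorial * ∑ i, g {i} := by
    rw [← sum_symmetrized_singleton]
    have : ∀ i, symmetrized g {i} = c := fun i =>
      symmetrized_eq_of_card_eq g (by simp)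
    simp [this]
  -- Integrand on the left: the chord `c * (k - #I)` for non-empty `I`, and `0` at `∅`, where only
  -- non-negativity is available. Its expectation is `c * (k - 1 - k * (1 - p) ^ k)`, and `k * (1 -
  -- p) = k - 1`.
  have h1 : sampled p univ (fun I : Finset (Fin k) =>
      c * k + (-c) * #I + (-(c * k)) * (if I = ∅ then 1 else 0)) ≤
      sampled p univ (fun I => (k - 1) * symmetrized g I) := by
    refine sampled_mono hp0 hp1 _ fun I => ?_
    rcases I.eq_empty_or_nonempty with rfl | hI
    · simpa using mul_nonneg (by linarith : (0 : ℝ) ≤ k - 1) (symmetrized_nonneg h0 _)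
    · have := symmetrized_ge h0 hg i₀ I hI
      rw [if_neg hI.ne_empty]
      nlinarith
  rw [sampled_add, sampled_add, sampled_const, sampled_const_mul, sampled_const_mul,
    sampled_const_mul, sampled_card, sampled_indicator_empty, sampled_symmetrized] at h1
  simp only [card_univ, Fintype.card_fin] at h1
  have e : (1 - p) ^ k = (1 - p) ^ (k - 1) * (1 - p) := by
    rw [← pow_succ]; congr 1; omega
  have hf : (0 : ℝ) < k.factorial := by exact_mod_cast k.factorial_pos
  have h2 : c * (k - 1) * (1 - (1 - p) ^ (k - 1)) ≤
      (k - 1) * (k.factorial * sampled p univ g) := by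
    refine le_trans (le_of_eq ?_) h1
    rw [e]
    linear_combination (-c * (1 - (1 - p) ^ (k - 1))) * hkp
  have h3 : c * (1 - (1 - p) ^ (k - 1)) ≤ k.factorial * sampled p univ g := by
    refine le_of_mul_le_mul_left ?_ (by linarith : (0 : ℝ) < k - 1)
    linarith
  refine le_of_mul_le_mul_left ?_ hf
  calc (k.factorial : ℝ) * ((1 - (1 - p) ^ (k - 1)) * ∑ i, g {i})
      = k * (c * (1 - (1 - p) ^ (k - 1))) := by
        linear_combination (-(1 - (1 - p) ^ (k - 1))) * hsum
    _ ≤ k * (k.factorial * sampled p univ g) := mul_le_mul_of_nonneg_left h3 hk0.le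
    _ = _ := by ring

end Symmetrization

/-! ### The approximation ratio of the uniform assignment. -/

section Ratio

variable {n k : ℕ}

theorem card_filter_part_eq (i : Fin k) (T : Finset (Fin n)) :
    #(univ.filter fun a : Allocation n k => part a i = T) = (k - 1) ^ (n - #T) := by
  have e : (univ.filter fun a : Allocation n k => part a i = T) =
      Fintype.piFinset fun u => if u ∈ T then {i} else {i}ᶜ := by
    ext a
    simp only [mem_filter, mem_univ, true_and, Fintype.mem_piFinset, part, Finset.ext_iff]
    refine forall_congr' fun u => ?_
    split_ifs with h <;> simp [h]
  rw [e, Fintype.card_piFinset]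
  have : ∀ u, #(if u ∈ T then ({i} : Finset (Fin k)) else {i}ᶜ) = if u ∈ T then 1 else k - 1 := by
    intro u
    split_ifs <;> simp [card_compl]
  simp only [this]
  rw [prod_ite, prod_const_one, one_mul, prod_const, filter_not, filter_mem_eq_inter, univ_inter,
    ← compl_eq_univ_sdiff, card_compl, Fintype.card_fin]

theorem average_part (hk : 1 ≤ k) (f : Finset (Fin n) → ℝ) (i : Fin k) :
    ((k : ℝ) ^ n)⁻¹ * ∑ a : Allocation n k, f (part a i) = sampled (1 / (k : ℝ)) univ f := by
  have hk0 : (k : ℝ) ≠ 0 := by positivity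
  rw [← sum_fiberwise univ (fun a : Allocation n k => part a i) fun a => f (part a i), mul_sum,
    sampled, powerset_univ]
  refine sum_congr rfl fun T _ => ?_
  have e : ∑ a ∈ univ.filter (fun a : Allocation n k => part a i = T), f (part a i) =
      ∑ a ∈ univ.filter (fun a : Allocation n k => part a i = T), f T :=
    sum_congr rfl fun a ha => by rw [(mem_filter.1 ha).2]
  rw [e, sum_const, card_filter_part_eq, nsmul_eq_mul, card_univ, Fintype.card_fin]
  have hT : #T + (n - #T) = n := by
    have := card_le_univ T
    rw [Fintype.card_fin] at this
    omega
  have e1 : (1 - 1 / (k : ℝ)) = (k - 1) / k := by field_simp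
  have e2 : (k : ℝ) ^ n = (k : ℝ) ^ #T * (k : ℝ) ^ (n - #T) := by rw [← pow_add, hT]
  rw [e1, e2, div_pow, div_pow, one_pow]
  push_cast [Nat.cast_sub hk]
  field_simp

theorem welfare_le_opt (f : Finset (Fin n) → ℝ) (a : Allocation n k) : welfare f a ≤ opt k f :=
  le_ciSup (Set.finite_range _).bddAbove a

theorem random_welfare_ge (hk : 1 ≤ k) {f : Finset (Fin n) → ℝ} (hf : IsUtility f) :
    (1 - (1 - 1 / (k : ℝ)) ^ (k - 1)) * opt k f ≤
      ((k : ℝ) ^ n)⁻¹ * ∑ a : Allocation n k, welfare f a := by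
  obtain rfl | hk2 : k = 1 ∨ 2 ≤ k := by omega
  · simp only [Nat.sub_self, pow_zero, sub_self, zero_mul]
    exact mul_nonneg (by positivity) (sum_nonneg fun _ _ => sum_nonneg fun _ _ => hf.nonneg _)
  have hk1 : (1 : ℝ) ≤ k := by exact_mod_cast hk
  have : Nonempty (Fin k) := ⟨⟨0, hk⟩⟩
  obtain ⟨o, ho⟩ := exists_eq_ciSup_of_finite (f := fun a : Allocation n k => welfare f a)
  have e : ((k : ℝ) ^ n)⁻¹ * ∑ a : Allocation n k, welfare f a =
      k * sampled (1 / (k : ℝ)) univ f := by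
    simp only [welfare]
    rw [sum_comm, mul_sum]
    simp [average_part hk]
  have hs : IsSubmodular f := hf.submodular
  -- The groups are the parts of the optimal allocation `o`.
  have h1 := hs.sampled_groups_le (p := 1 / (k : ℝ)) (by positivity)
    (by rw [div_le_one (by linarith)]; exact hk1) o univ
  have h2 := sampled_ge_sum_singleton hk2 (g := fun I => f (univ.filter fun u => o u ∈ I))
    (fun I => hf.nonneg _) (fun A B => by
      have := hf.submodular (univ.filter fun u => o u ∈ A) (univ.filter fun u => o u ∈ B)
      rw [← filter_or, ← filter_and] at this
      simpa only [mem_union, mem_inter] using this)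
  rw [e, opt, ← ho]
  simp only [mem_univ, filter_true] at h1
  simp only [mem_singleton] at h2
  exact h2.trans (mul_le_mul_of_nonneg_left h1 (by linarith))

theorem randomProgram_hasRatio (hk : 1 ≤ k) :
    (randomProgram.algorithm n k).HasRatio (1 - (1 - 1 / (k : ℝ)) ^ (k - 1)) := fun f hf => by
  rw [randomProgram_expectedWelfare hk]
  exact random_welfare_ge hk hf

end Ratio

end
end SubmodularWelfare

/-! ### The product of coordinates after cutting off a fixed total amount at the top. -/

namespace SubmodularWelfare
noncomputable section
open Finset

theorem le_add_single {ι : Type*} [DecidableEq ι] (x : ι → ℝ) (i : ι) {s : ℝ} (hs : 0 ≤ s) :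
    x ≤ x + Pi.single i s :=
  le_add_of_nonneg_right (Pi.single_nonneg.2 hs)

section CutProduct

variable {ι : Type*} [Fintype ι]

/-- The total amount by which the coordinates of `x` exceed `l`. -/
def excess (x : ι → ℝ) (l : ℝ) : ℝ := ∑ i, max (x i - l) 0

open Classical in
/-- The level above which the coordinates of `x` have total excess `Δ`. -/
def level (Δ : ℝ) (x : ι → ℝ) : ℝ :=
  if h : ∃ l, 0 < l ∧ excess x l = Δ then h.choose else 0

/-- The coordinates of `x`, cut off at the level where a total amount `Δ` is removed. -/
def cut (Δ : ℝ) (x : ι → ℝ) (i : ι) : ℝ := min (x i) (level Δ x)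

/-- The product of the coordinates that remain after a total amount `Δ` is cut off at the top. -/
def cutProd (Δ : ℝ) (x : ι → ℝ) : ℝ := ∏ i, cut Δ x i

/-- The vectors from which a total amount `Δ` can be cut off properly. -/
structure Cuttable (Δ : ℝ) (x : ι → ℝ) : Prop where
  amount_pos : 0 < Δ
  pos : ∀ i, 0 < x i
  lt_sum : Δ < ∑ i, x i

theorem excess_mono {x y : ι → ℝ} (h : x ≤ y) (l : ℝ) : excess x l ≤ excess y l :=
  sum_le_sum fun i _ => max_le_max_right 0 (sub_le_sub_right (h i) l)

theorem excess_lt {x : ι → ℝ} {l l' : ℝ} (h : l < l') (hpos : 0 < excess x l') :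
    excess x l' < excess x l := by
  obtain ⟨i, -, hi⟩ : ∃ i ∈ univ, 0 < max (x i - l') 0 := by
    by_contra! H
    exact hpos.not_ge (sum_nonpos H)
  refine sum_lt_sum (fun j _ => max_le_max_right 0 (by linarith)) ⟨i, mem_univ i, ?_⟩
  have h1 : 0 < x i - l' := by simpa using hi
  rw [max_eq_left h1.le, max_eq_left (by linarith)]
  linarith

namespace Cuttable

variable {Δ : ℝ} {x y : ι → ℝ}

theorem mono (h : Cuttable Δ x) (hxy : x ≤ y) : Cuttable Δ y :=
  ⟨h.amount_pos, fun i => (h.pos i).trans_le (hxy i),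
    h.lt_sum.trans_le (sum_le_sum fun i _ => hxy i)⟩

theorem exists_level (h : Cuttable Δ x) : ∃ l, 0 < l ∧ excess x l = Δ := by
  have hc : Continuous (excess x) := by unfold excess; fun_prop
  have h0 : excess x 0 = ∑ i, x i := by
    refine sum_congr rfl fun i _ => ?_
    rw [sub_zero, max_eq_left (h.pos i).le]
  have hle : ∀ i, x i ≤ ∑ j, x j := fun i =>
    single_le_sum (f := x) (fun j _ => (h.pos j).le) (mem_univ i)
  have h1 : excess x (∑ i, x i) = 0 :=
    sum_eq_zero fun i _ => max_eq_right (sub_nonpos.2 (hle i))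
  have hs : 0 ≤ ∑ i, x i := sum_nonneg fun i _ => (h.pos i).le
  obtain ⟨l, hl, hl'⟩ := intermediate_value_Icc' hs hc.continuousOn
    (show Δ ∈ Set.Icc _ _ from ⟨h1 ▸ h.amount_pos.le, h0 ▸ h.lt_sum.le⟩)
  refine ⟨l, lt_of_le_of_ne hl.1 ?_, hl'⟩
  rintro rfl
  exact h.lt_sum.ne (hl'.symm.trans h0)

theorem level_spec (h : Cuttable Δ x) : 0 < level Δ x ∧ excess x (level Δ x) = Δ := by
  rw [level, dif_pos h.exists_level]
  exact h.exists_level.choose_spec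

/-- Raising coordinates raises the excess over any level, while the excess strictly decreases in the
level as long as it is positive. -/
theorem level_mono (h : Cuttable Δ x) (hxy : x ≤ y) : level Δ x ≤ level Δ y := by
  by_contra! hlt
  have h1 := h.level_spec.2
  have h2 := (h.mono hxy).level_spec.2
  have h3 := excess_lt hlt (h1 ▸ h.amount_pos)
  have h4 := excess_mono hxy (level Δ y)
  linarith

theorem level_eq (h : Cuttable Δ x) {l : ℝ} (hl : excess x l = Δ) : level Δ x = l := by
  have h1 := h.level_spec.2
  rcases lt_trichotomy (level Δ x) l with hlt | heq | hlt
  · exact absurd (excess_lt hlt (hl ▸ h.amount_pos)) (by rw [hl, h1]; exact lt_irrefl _)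
  · exact heq
  · exact absurd (excess_lt hlt (h1 ▸ h.amount_pos)) (by rw [hl, h1]; exact lt_irrefl _)

theorem cut_pos (h : Cuttable Δ x) (i : ι) : 0 < cut Δ x i := lt_min (h.pos i) h.level_spec.1

theorem cut_mono (h : Cuttable Δ x) (hxy : x ≤ y) (i : ι) : cut Δ x i ≤ cut Δ y i :=
  min_le_min (hxy i) (h.level_mono hxy)

theorem cutProd_pos (h : Cuttable Δ x) : 0 < cutProd Δ x := prod_pos fun i _ => h.cut_pos i

theorem sum_cut (h : Cuttable Δ x) : ∑ i, cut Δ x i = ∑ i, x i - Δ := by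
  have e : ∀ i, cut Δ x i = x i - max (x i - level Δ x) 0 := fun i => by
    rcases le_total (x i) (level Δ x) with hi | hi
    · rw [cut, min_eq_left hi, max_eq_right (by linarith), sub_zero]
    · rw [cut, min_eq_right hi, max_eq_left (by linarith)]; ring
  simp only [e, sum_sub_distrib]
  rw [← excess, h.level_spec.2]

end Cuttable

/-- The inequality of arithmetic and geometric means, from `r ≤ exp (r - 1)`. -/
theorem prod_le_one_of_sum_le_card {r : ι → ℝ} (h0 : ∀ i, 0 ≤ r i)
    (h : ∑ i, r i ≤ Fintype.card ι) : ∏ i, r i ≤ 1 := by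
  calc ∏ i, r i ≤ ∏ i, Real.exp (r i - 1) :=
        prod_le_prod (fun i _ => h0 i) fun i _ => by
          have := Real.add_one_le_exp (r i - 1)
          linarith
    _ = Real.exp (∑ i, (r i - 1)) := (Real.exp_sum _ _).symm
    _ ≤ 1 := by
        rw [Real.exp_le_one_iff, sum_sub_distrib]
        simpa using h

namespace Cuttable

variable {Δ : ℝ} {x y : ι → ℝ}

/-- Cutting off at the top maximizes the product. -/
theorem prod_le_cutProd (h : Cuttable Δ x) {z : ι → ℝ} (hz0 : ∀ i, 0 ≤ z i) (hzx : z ≤ x)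
    (hz : ∑ i, z i = ∑ i, x i - Δ) : ∏ i, z i ≤ cutProd Δ x := by
  have hl := h.level_spec.1
  have key : ∏ i, z i / cut Δ x i ≤ 1 := by
    refine prod_le_one_of_sum_le_card (fun i => div_nonneg (hz0 i) (h.cut_pos i).le) ?_
    -- Optimality condition: at coordinates cut to the level this is an equality; at the others `z i
    -- ≤ x i = cut Δ x i ≤ level Δ x`. Summing cancels the last term, since `z` and the cut vector
    -- have equal sums.
    have h1 : ∀ i, z i / cut Δ x i ≤ 1 + (z i - cut Δ x i) / level Δ x := fun i => by
      have hc := h.cut_pos i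
      rcases le_total (x i) (level Δ x) with hi | hi
      · have e : cut Δ x i = x i := min_eq_left hi
        rw [e] at hc ⊢
        have h2 : (x i - z i) / level Δ x ≤ (x i - z i) / x i :=
          div_le_div_of_nonneg_left (sub_nonneg.2 (hzx i)) hc hi
        have h3 : (x i - z i) / x i = 1 - z i / x i := by rw [sub_div, div_self hc.ne']
        have h4 : (z i - x i) / level Δ x = -((x i - z i) / level Δ x) := by ring
        linarith
      · have e : cut Δ x i = level Δ x := min_eq_right hi
        rw [e, sub_div, div_self hl.ne']
        linarith
    calc ∑ i, z i / cut Δ x i ≤ ∑ i, (1 + (z i - cut Δ x i) / level Δ x) :=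
          sum_le_sum fun i _ => h1 i
      _ = Fintype.card ι + (∑ i, z i - ∑ i, cut Δ x i) / level Δ x := by
          rw [sum_add_distrib, ← sum_div, sum_sub_distrib]; simp
      _ = Fintype.card ι := by rw [hz, h.sum_cut]; simp
  rw [prod_div_distrib, div_le_one (prod_pos fun i _ => h.cut_pos i)] at key
  exact key

theorem cutProd_le_pow (h : Cuttable Δ x) {m : ℝ} (hm : ∑ i, x i - Δ = Fintype.card ι * m)
    (hm0 : 0 < m) : cutProd Δ x ≤ m ^ Fintype.card ι := by
  have key : ∏ i, cut Δ x i / m ≤ 1 := by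
    refine prod_le_one_of_sum_le_card (fun i => div_nonneg (h.cut_pos i).le hm0.le) ?_
    rw [← sum_div, h.sum_cut, hm, mul_div_assoc, div_self hm0.ne', mul_one]
  rw [prod_div_distrib, prod_const, card_univ, div_le_one (pow_pos hm0 _)] at key
  exact key

/-- If all coordinates are at least the mean `m` left after the cut, the level is exactly `m` and
the vector is flattened completely. -/
theorem cutProd_eq_pow (h : Cuttable Δ x) {m : ℝ} (hm : ∑ i, x i - Δ = Fintype.card ι * m)
    (hx : ∀ i, m ≤ x i) : cutProd Δ x = m ^ Fintype.card ι := by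
  have hl : level Δ x = m := h.level_eq (by
    have : ∀ i, max (x i - m) 0 = x i - m := fun i => max_eq_left (sub_nonneg.2 (hx i))
    simp only [excess, this, sum_sub_distrib, sum_const, card_univ, nsmul_eq_mul]
    linarith)
  simp [cutProd, cut, hl, hx]

variable [DecidableEq ι]

theorem sum_add_single (x : ι → ℝ) (i : ι) (s : ℝ) :
    ∑ j, (x + Pi.single i s : ι → ℝ) j = ∑ j, x j + s := by
  simp [sum_add_distrib]

theorem prod_add_single (z : ι → ℝ) (i : ι) (s : ℝ) :
    ∏ j, (z + Pi.single i s : ι → ℝ) j = ∏ j, z j + s * ∏ j ∈ univ.erase i, z j := by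
  rw [← mul_prod_erase univ _ (mem_univ i), ← mul_prod_erase univ z (mem_univ i)]
  have : ∏ j ∈ univ.erase i, (z + Pi.single i s : ι → ℝ) j = ∏ j ∈ univ.erase i, z j :=
    prod_congr rfl fun j hj => by simp [Pi.single_eq_of_ne (ne_of_mem_erase hj)]
  rw [this]
  simp
  ring

/-- The partial derivative of `cutProd` in the `i`-th coordinate. -/
def _root_.SubmodularWelfare.cutSlope (Δ : ℝ) (i : ι) (x : ι → ℝ) : ℝ :=
  ∏ j ∈ univ.erase i, cut Δ x j

theorem cutSlope_mono (h : Cuttable Δ x) (i : ι) (hxy : x ≤ y) :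
    cutSlope Δ i x ≤ cutSlope Δ i y :=
  prod_le_prod (fun j _ => (h.cut_pos j).le) fun j _ => h.cut_mono hxy j

/-- The optimal vector for `x`, increased by `s` in coordinate `i`, competes in the maximum for the
increased `x`. -/
theorem cutProd_add_single_ge (h : Cuttable Δ x) (i : ι) {s : ℝ} (hs : 0 ≤ s) :
    s * cutSlope Δ i x ≤ cutProd Δ (x + Pi.single i s) - cutProd Δ x := by
  have h1 := (h.mono (le_add_single x i hs)).prod_le_cutProd (z := cut Δ x + Pi.single i s)
    (fun j => add_nonneg (h.cut_pos j).le ((Pi.single_nonneg (α := fun _ => ℝ)).2 hs j))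
    (add_le_add_left (fun j => min_le_left _ _) _)
    (by rw [sum_add_single, sum_add_single, h.sum_cut]; ring)
  rw [prod_add_single] at h1
  rw [cutSlope, cutProd, cutProd] at *
  linarith

/-- Conversely, the optimal vector for `y` decreased by `s` in coordinate `i` competes in the
maximum for `x`. -/
theorem cutProd_add_single_le (h : Cuttable Δ x) (i : ι) {s : ℝ} (hs : 0 ≤ s) :
    cutProd Δ (x + Pi.single i s) - cutProd Δ x ≤ s * cutSlope Δ i (x + Pi.single i s) := by
  set y := x + Pi.single i s with hy
  have hY : Cuttable Δ y := h.mono (le_add_single x i hs)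
  have h1 : ∏ j, (cut Δ y + Pi.single i (-s) : ι → ℝ) j ≤ cutProd Δ x := by
    rcases le_total s (cut Δ y i) with hsi | hsi
    · refine h.prod_le_cutProd (fun j => ?_) (fun j => ?_) ?_
      · by_cases hj : j = i
        · subst hj; simpa using hsi
        · simpa [Pi.single_eq_of_ne hj] using (hY.cut_pos j).le
      · have : cut Δ y j ≤ y j := min_le_left _ _
        by_cases hj : j = i
        · subst hj; simp [hy] at this ⊢; linarith
        · simpa [hy, Pi.single_eq_of_ne hj] using this
      · rw [sum_add_single, hY.sum_cut, hy, sum_add_single]; ring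
    -- Here the decreased coordinate is not positive, so the vector may be infeasible, but its
    -- product is at most `0`.
    · refine le_trans ?_ h.cutProd_pos.le
      rw [← mul_prod_erase univ _ (mem_univ i)]
      refine mul_nonpos_of_nonpos_of_nonneg (by simpa using hsi) (prod_nonneg fun j hj => ?_)
      simpa [Pi.single_eq_of_ne (ne_of_mem_erase hj)] using (hY.cut_pos j).le
  rw [prod_add_single] at h1
  rw [cutSlope, cutProd]
  linarith

end Cuttable

/-- A function whose increments are bounded above by `g` at the right end point grows less than
one whose increments are bounded below by `g'` at the left end point, if `g ≤ g'`. -/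
theorem sub_le_sub_of_slopes {φ ψ g g' : ℝ → ℝ} {a : ℝ} (ha : 0 ≤ a)
    (hφ : ∀ s h, 0 ≤ s → 0 ≤ h → φ (s + h) - φ s ≤ h * g (s + h))
    (hψ : ∀ s h, 0 ≤ s → 0 ≤ h → h * g' s ≤ ψ (s + h) - ψ s)
    (hg : ∀ s, 0 ≤ s → g s ≤ g' s) : φ a - φ 0 ≤ ψ a - ψ 0 := by
  -- On a subdivision of `[0, a]` into `N + 1` equal steps, right and left end point values of `g`
  -- differ by a telescoping sum, so the error vanishes as `N` grows.
  have key : ∀ N : ℕ, (φ a - φ 0) - (ψ a - ψ 0) ≤ a * (g a - g 0) / (N + 1 : ℕ) := fun N => by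
    set h := a / (N + 1 : ℕ) with hh
    have hN : ((N + 1 : ℕ) : ℝ) ≠ 0 := by positivity
    have hh0 : 0 ≤ h := by positivity
    have hend : ((N + 1 : ℕ) : ℝ) * h = a := by rw [hh]; field_simp
    have e1 : φ a - φ 0 = ∑ l ∈ range (N + 1), (φ ((l + 1 : ℕ) * h) - φ ((l : ℕ) * h)) := by
      rw [sum_range_sub fun l : ℕ => φ (l * h), hend]; simp
    have e2 : ψ a - ψ 0 = ∑ l ∈ range (N + 1), (ψ ((l + 1 : ℕ) * h) - ψ ((l : ℕ) * h)) := by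
      rw [sum_range_sub fun l : ℕ => ψ (l * h), hend]; simp
    have e3 : g a - g 0 = ∑ l ∈ range (N + 1), (g ((l + 1 : ℕ) * h) - g ((l : ℕ) * h)) := by
      rw [sum_range_sub fun l : ℕ => g (l * h), hend]; simp
    rw [mul_div_right_comm, ← hh, e1, e2, e3, ← sum_sub_distrib, mul_sum]
    refine sum_le_sum fun l _ => ?_
    have e : ((l + 1 : ℕ) : ℝ) * h = l * h + h := by push_cast; ring
    have hl : (0 : ℝ) ≤ l * h := by positivity
    have h1 := hφ (l * h) h hl hh0
    have h2 := hψ (l * h) h hl hh0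
    have h3 := mul_le_mul_of_nonneg_left (hg (l * h) hl) hh0
    rw [e]
    linarith
  have hlim : Filter.Tendsto (fun N : ℕ => a * (g a - g 0) / (N + 1 : ℕ)) Filter.atTop (nhds 0) :=
    (tendsto_const_div_atTop_nhds_zero_nat _).comp (Filter.tendsto_add_atTop_nat 1)
  linarith [ge_of_tendsto' hlim key]

/-- The increments of `cutProd` in a coordinate direction are monotone. -/
theorem Cuttable.cutProd_increment_mono [DecidableEq ι] {Δ : ℝ} {x y : ι → ℝ}
    (h : Cuttable Δ x) (hxy : x ≤ y) (i : ι) {a : ℝ} (ha : 0 ≤ a) :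
    cutProd Δ (x + Pi.single i a) - cutProd Δ x ≤ cutProd Δ (y + Pi.single i a) - cutProd Δ y := by
  have hx : ∀ s, 0 ≤ s → Cuttable Δ (x + Pi.single i s) := fun s hs =>
    h.mono (le_add_single x i hs)
  have hy : ∀ s, 0 ≤ s → Cuttable Δ (y + Pi.single i s) := fun s hs =>
    (h.mono hxy).mono (le_add_single y i hs)
  have key := sub_le_sub_of_slopes (φ := fun s => cutProd Δ (x + Pi.single i s))
    (ψ := fun s => cutProd Δ (y + Pi.single i s))
    (g := fun s => cutSlope Δ i (x + Pi.single i s))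
    (g' := fun s => cutSlope Δ i (y + Pi.single i s)) ha
    (fun s t hs ht => by
      have := (hx s hs).cutProd_add_single_le i ht
      rwa [add_assoc, ← Pi.single_add] at this)
    (fun s t hs ht => by
      have := (hy s hs).cutProd_add_single_ge i ht
      rwa [add_assoc, ← Pi.single_add] at this)
    (fun s hs => (hx s hs).cutSlope_mono i (add_le_add_left hxy _))
  simpa using key

end CutProduct

end
end SubmodularWelfare

/-! ### The hard instances: submodularity, welfare, and rarity of unbalanced sets. -/

namespace SubmodularWelfare
noncomputable section
open Finset

section Instances

variable {n k : ℕ}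

theorem add_le_of_increments {h : Finset (Fin n) → ℝ}
    (H : ∀ A B u, A ⊆ B → u ∉ B → h (insert u A) - h A ≤ h (insert u B) - h B)
    (A B : Finset (Fin n)) : h A + h B ≤ h (A ∪ B) + h (A ∩ B) := by
  have key : ∀ D A B : Finset (Fin n), A ⊆ B → Disjoint D B →
      h (D ∪ A) - h A ≤ h (D ∪ B) - h B := by
    intro D
    induction D using Finset.induction with
    | empty => intro A B _ _; simp
    | insert u D hu ih =>
      intro A B hAB hD
      rw [disjoint_insert_left] at hD
      have h1 := ih A B hAB hD.2
      have h2 := H (D ∪ A) (D ∪ B) u (union_subset_union_right hAB) (by simp [hu, hD.1])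
      rw [insert_union, insert_union]
      linarith
  have h1 := key (A \ B) (A ∩ B) B inter_subset_right sdiff_disjoint
  rw [sdiff_union_inter, sdiff_union_self_eq_union] at h1
  linarith

/-- Monotone increments make `h` supermodular, so `m - h` is submodular; complementation only
exchanges unions and intersections. -/
theorem isUtility_of_increments {m h : Finset (Fin n) → ℝ}
    (hm : ∀ A B, m (A ∪ B) + m (A ∩ B) = m A + m B)
    (H : ∀ A B u, A ⊆ B → u ∉ B → h (insert u A) - h A ≤ h (insert u B) - h B)
    (hle : ∀ A, h A ≤ m A) : IsUtility fun S => m Sᶜ - h Sᶜ where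
  nonneg S := sub_nonneg.2 (hle _)
  submodular A B := by
    have h1 := add_le_of_increments H Aᶜ Bᶜ
    have h2 := hm Aᶜ Bᶜ
    rw [compl_union, compl_inter]
    linarith

theorem pow_increment_mono {s t a : ℝ} (hs : 0 ≤ s) (hst : s ≤ t) (ha : 0 ≤ a) (k : ℕ) :
    (s + a) ^ k - s ^ k ≤ (t + a) ^ k - t ^ k := by
  induction k with
  | zero => simp
  | succ k ih =>
    have e : ∀ s : ℝ, (s + a) ^ (k + 1) - s ^ (k + 1) =
        (s + a) * ((s + a) ^ k - s ^ k) + a * s ^ k := fun s => by ring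
    rw [e, e]
    have h0 : 0 ≤ (s + a) ^ k - s ^ k := sub_nonneg.2 (pow_le_pow_left₀ hs (by linarith) k)
    have h1 : s ^ k ≤ t ^ k := pow_le_pow_left₀ hs hst k
    exact add_le_add (mul_le_mul (by linarith) ih h0 (by linarith))
      (mul_le_mul_of_nonneg_left h1 ha)

/-- The proportion of items in `T`, rescaled to the interval `[η, 1]`. -/
def density (η : ℝ) (T : Finset (Fin n)) : ℝ := η + (1 - η) * (#T / n)

/-- The proportions of items of the different colors in `T`, rescaled so that they are at least
`density η T` on the sets `T` in which all colors are roughly equally frequent. -/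
def profile (η : ℝ) (c : Allocation n k) (T : Finset (Fin n)) (i : Fin k) : ℝ :=
  2 * η + (1 - η) * (k / n) * #(T.filter fun u => c u = i)

/-- The utility function that hides the coloring `c`. -/
def hidden (η : ℝ) (c : Allocation n k) (S : Finset (Fin n)) : ℝ :=
  density η Sᶜ - cutProd (k * η) (profile η c Sᶜ)

/-- The utility function that only depends on the number of items. -/
def symmetric (k : ℕ) (η : ℝ) (S : Finset (Fin n)) : ℝ :=
  density η Sᶜ - density η Sᶜ ^ k

/-- The sets on which `hidden η c` and `symmetric k η` agree by construction. -/
def Balanced (η : ℝ) (c : Allocation n k) (S : Finset (Fin n)) : Prop :=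
  ∀ i, density η Sᶜ ≤ profile η c Sᶜ i

variable {η : ℝ}

theorem density_modular (A B : Finset (Fin n)) :
    density η (A ∪ B) + density η (A ∩ B) = density η A + density η B := by
  have : (#(A ∪ B) : ℝ) + #(A ∩ B) = #A + #B := by exact_mod_cast card_union_add_card_inter A B
  simp only [density]
  rw [← sub_eq_zero]
  linear_combination ((1 - η) / n) * this

theorem density_insert {u : Fin n} {T : Finset (Fin n)} (hu : u ∉ T) :
    density η (insert u T) = density η T + (1 - η) / n := by
  rw [density, density, card_insert_of_notMem hu]
  push_cast
  ring

theorem density_mono (h1 : η ≤ 1) {A B : Finset (Fin n)} (h : A ⊆ B) :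
    density η A ≤ density η B := by
  unfold density
  have : (#A : ℝ) ≤ #B := by exact_mod_cast card_le_card h
  have h2 : 0 ≤ 1 - η := by linarith
  gcongr

theorem density_pos (h0 : 0 < η) (h1 : η ≤ 1) (T : Finset (Fin n)) : 0 < density η T := by
  have h2 : 0 ≤ 1 - η := by linarith
  unfold density
  positivity

theorem density_le_one (h1 : η ≤ 1) (T : Finset (Fin n)) : density η T ≤ 1 := by
  have h2 : (#T : ℝ) / n ≤ 1 := by
    refine div_le_one_of_le₀ ?_ n.cast_nonneg
    exact_mod_cast (card_le_univ T).trans_eq (Fintype.card_fin n)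
  unfold density
  nlinarith

/-- The shift `2 * η` in `profile` against `η` in `density` creates a surplus of `k * η`; cutting
off this amount makes the remaining mean equal to the density. -/
theorem sum_profile (c : Allocation n k) (T : Finset (Fin n)) :
    ∑ i, profile η c T i - k * η = Fintype.card (Fin k) * density η T := by
  have h : ∑ i, (#(T.filter fun u => c u = i) : ℝ) = #T := by
    exact_mod_cast (card_eq_sum_card_fiberwise fun _ _ => mem_coe.2 (mem_univ _)).symm
  simp only [profile, sum_add_distrib, ← mul_sum, h, density]
  simp
  ring

theorem cuttable_profile (h0 : 0 < η) (h1 : η ≤ 1) (hk : 1 ≤ k) (c : Allocation n k)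
    (T : Finset (Fin n)) : Cuttable (k * η) (profile η c T) where
  amount_pos := mul_pos (by exact_mod_cast hk) h0
  pos i := by
    have h2 : 0 ≤ 1 - η := by linarith
    unfold profile
    positivity
  lt_sum := by
    have h2 := sum_profile (η := η) c T
    have h3 : (0 : ℝ) < Fintype.card (Fin k) * density η T :=
      mul_pos (by simp; omega) (density_pos h0 h1 T)
    linarith

theorem profile_mono (h1 : η ≤ 1) (c : Allocation n k) {A B : Finset (Fin n)} (h : A ⊆ B) :
    profile η c A ≤ profile η c B := fun i => by
  have h2 : 0 ≤ 1 - η := by linarith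
  have h3 : (#(A.filter fun u => c u = i) : ℝ) ≤ #(B.filter fun u => c u = i) := by
    exact_mod_cast card_le_card (filter_subset_filter _ h)
  unfold profile
  gcongr

theorem profile_insert (c : Allocation n k) {u : Fin n} {T : Finset (Fin n)} (hu : u ∉ T) :
    profile η c (insert u T) = profile η c T + Pi.single (c u) ((1 - η) * (k / n)) := by
  funext i
  rw [Pi.add_apply, profile, profile, filter_insert]
  by_cases h : c u = i
  · subst h
    rw [if_pos rfl, card_insert_of_notMem (by simp [hu]), Pi.single_eq_same]
    push_cast
    ring
  · rw [if_neg h, Pi.single_eq_of_ne (Ne.symm h), add_zero]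

theorem hidden_isUtility (h0 : 0 < η) (h1 : η ≤ 1) (hk : 1 ≤ k) (c : Allocation n k) :
    IsUtility (hidden η c) := by
  refine isUtility_of_increments (h := fun T => cutProd (k * η) (profile η c T))
    density_modular (fun A B u hAB hu => ?_) fun T => ?_
  · simp only [profile_insert c hu, profile_insert c fun h => hu (hAB h)]
    exact (cuttable_profile h0 h1 hk c A).cutProd_increment_mono (profile_mono h1 c hAB) _
      (mul_nonneg (by linarith) (by positivity))
  · refine ((cuttable_profile h0 h1 hk c T).cutProd_le_pow (sum_profile c T)
      (density_pos h0 h1 T)).trans ?_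
    exact pow_le_of_le_one (density_pos h0 h1 T).le (density_le_one h1 T) (by simp; omega)

theorem symmetric_isUtility (h0 : 0 < η) (h1 : η ≤ 1) (hk : 1 ≤ k) :
    IsUtility (symmetric (n := n) k η) := by
  refine isUtility_of_increments (h := fun T => density η T ^ k)
    density_modular (fun A B u hAB hu => ?_) fun T => ?_
  · simp only [density_insert hu, density_insert fun h => hu (hAB h)]
    exact pow_increment_mono (density_pos h0 h1 A).le (density_mono h1 hAB)
      (div_nonneg (by linarith) n.cast_nonneg) k
  · exact pow_le_of_le_one (density_pos h0 h1 T).le (density_le_one h1 T) (by omega)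

theorem hidden_eq_symmetric (h0 : 0 < η) (h1 : η ≤ 1) (hk : 1 ≤ k) {c : Allocation n k}
    {S : Finset (Fin n)} (h : Balanced η c S) : hidden η c S = symmetric k η S := by
  rw [hidden, symmetric, (cuttable_profile h0 h1 hk c Sᶜ).cutProd_eq_pow (sum_profile c _) h,
    Fintype.card_fin]

theorem hidden_le_one (h0 : 0 < η) (h1 : η ≤ 1) (hk : 1 ≤ k) (c : Allocation n k)
    (S : Finset (Fin n)) : hidden η c S ≤ 1 := by
  have := (cuttable_profile h0 h1 hk c Sᶜ).cutProd_pos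
  have := density_le_one h1 Sᶜ
  unfold hidden
  linarith

theorem sum_density_part (hn : 0 < n) (a : Allocation n k) :
    ∑ i, density η (part a i)ᶜ = k - 1 + η := by
  have h : ∑ i, (#(part a i) : ℝ) = n := by
    have := card_eq_sum_card_fiberwise (s := univ) (t := univ) (f := a)
      fun _ _ => mem_coe.2 (mem_univ _)
    rw [card_univ, Fintype.card_fin] at this
    exact_mod_cast this.symm
  have hc : ∀ i, (#(part a i)ᶜ : ℝ) = n - #(part a i) := fun i => by
    have := card_add_card_compl (part a i)
    rw [Fintype.card_fin] at this
    rw [eq_sub_iff_add_eq, add_comm]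
    exact_mod_cast this
  have hn' : (n : ℝ) ≠ 0 := by positivity
  simp only [density, hc, sum_add_distrib, ← mul_sum, ← sum_div, sum_sub_distrib, h]
  simp
  field_simp
  ring

/-- The complement densities have the fixed sum `k - 1 + η`, so convexity of `x ^ k` favours parts
of equal size. -/
theorem welfare_symmetric_le (h0 : 0 < η) (h1 : η ≤ 1) (hn : 0 < n) (hk : 2 ≤ k)
    (a : Allocation n k) :
    welfare (symmetric k η) a ≤ (k - 1) * (1 - (1 - 1 / (k : ℝ)) ^ (k - 1)) + η := by
  have hk2 : (2 : ℝ) ≤ k := by exact_mod_cast hk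
  set p : ℝ := 1 - 1 / k with hp
  have hkp : k * p = k - 1 := by rw [hp]; field_simp
  have hp0 : 0 < p := by
    refine pos_of_mul_pos_right (?_ : 0 < k * p) (by linarith)
    linarith
  -- Tangent of `x ^ k` at `p`, the mean density when `η = 0`; it is Bernoulli's inequality.
  have tangent : ∀ i, p ^ k + k * p ^ (k - 1) * (density η (part a i)ᶜ - p) ≤
      density η (part a i)ᶜ ^ k := fun i => by
    set m := density η (part a i)ᶜ
    have hm : 0 < m := density_pos h0 h1 _
    have h2 := one_add_mul_le_pow (a := m / p - 1) (by have := div_pos hm hp0; linarith) k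
    have h3 := mul_le_mul_of_nonneg_left h2 (pow_pos hp0 k).le
    rw [← mul_pow] at h3
    have e1 : p * (1 + (m / p - 1)) = m := by field_simp; ring
    have e2 : p ^ k = p ^ (k - 1) * p := by rw [← pow_succ]; congr 1; omega
    rw [e1] at h3
    refine le_trans (le_of_eq ?_) h3
    rw [e2]
    field_simp
  have hsum := sum_le_sum fun i (_ : i ∈ (univ : Finset (Fin k))) => tangent i
  rw [sum_add_distrib, ← mul_sum, sum_sub_distrib, sum_density_part hn] at hsum
  simp only [sum_const, card_univ, Fintype.card_fin, nsmul_eq_mul] at hsum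
  have e : k * p ^ k = (k - 1) * p ^ (k - 1) := by
    rw [← hkp, mul_right_comm, mul_assoc, ← pow_succ]; congr 2; omega
  have h2 : 0 ≤ k * p ^ (k - 1) * η := by positivity
  simp only [welfare, symmetric, sum_sub_distrib]
  rw [sum_density_part hn]
  rw [hkp, e] at hsum
  linarith

/-- The complement of color class `i` contains no item of color `i`, so one factor of the product is
at most `2 * η`; the others are at most `k`. -/
theorem welfare_hidden_ge (h0 : 0 < η) (h1 : η ≤ 1) (hn : 0 < n) (hk : 1 ≤ k)
    (c : Allocation n k) : (k : ℝ) - 1 - 2 * η * k ^ k ≤ welfare (hidden η c) c := by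
  have hcut : ∀ i, cutProd (k * η) (profile η c (part c i)ᶜ) ≤ 2 * η * k ^ (k - 1) := fun i => by
    have hx := cuttable_profile h0 h1 hk c (part c i)ᶜ
    have hs := hx.sum_cut
    rw [sum_profile] at hs
    have hi : cut (k * η) (profile η c (part c i)ᶜ) i ≤ 2 * η := by
      refine (min_le_left _ _).trans_eq ?_
      have : ((part c i)ᶜ.filter fun u => c u = i) = ∅ := by
        ext u; simp [part]
      rw [profile, this]
      simp
    have hj : ∀ j, cut (k * η) (profile η c (part c i)ᶜ) j ≤ k := fun j => by
      refine (single_le_sum (fun j _ => (hx.cut_pos j).le) (mem_univ j)).trans ?_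
      rw [hs, Fintype.card_fin]
      exact mul_le_of_le_one_right k.cast_nonneg (density_le_one h1 _)
    rw [cutProd, ← mul_prod_erase univ _ (mem_univ i)]
    refine mul_le_mul hi ?_ (prod_nonneg fun j _ => (hx.cut_pos j).le) (by positivity)
    refine (prod_le_prod (fun j _ => (hx.cut_pos j).le) fun j _ => hj j).trans_eq ?_
    rw [prod_const, card_erase_of_mem (mem_univ i), card_univ, Fintype.card_fin]
  have hsum := sum_le_sum fun i (_ : i ∈ (univ : Finset (Fin k))) => hcut i
  simp only [sum_const, card_univ, Fintype.card_fin, nsmul_eq_mul] at hsum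
  have e : (k : ℝ) * (2 * η * k ^ (k - 1)) = 2 * η * k ^ k := by
    rw [mul_left_comm, ← pow_succ']; congr 2; omega
  simp only [welfare, hidden, sum_sub_distrib]
  rw [sum_density_part hn]
  linarith

/-- Moment generating function of a mean-zero variable, from `exp x ≤ 1 + x + x ^ 2` for `|x| ≤ 1`.
-/
theorem exp_average_le (hk : 1 ≤ k) {s : ℝ} (hs : 0 ≤ s) (hsk : s * k ≤ 1) (i : Fin k) :
    ∑ j : Fin k, Real.exp (s * (1 - k * if j = i then 1 else 0)) ≤ k * Real.exp (s ^ 2 * k) := by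
  have hk1 : (1 : ℝ) ≤ k := by exact_mod_cast hk
  have bound : ∀ x : ℝ, |x| ≤ 1 → Real.exp x ≤ 1 + x + x ^ 2 := fun x hx => by
    have := (abs_le.1 (Real.abs_exp_sub_one_sub_id_le hx)).2
    linarith
  rw [← add_sum_erase univ _ (mem_univ i)]
  have e : ∑ j ∈ univ.erase i, Real.exp (s * (1 - k * if j = i then 1 else 0)) =
      (k - 1) * Real.exp s := by
    rw [sum_congr rfl fun j hj => by rw [if_neg (ne_of_mem_erase hj)], sum_const,
      card_erase_of_mem (mem_univ i), card_univ, Fintype.card_fin, nsmul_eq_mul, Nat.cast_sub hk]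
    simp
  rw [e, if_pos rfl]
  have h1 := bound (s * (1 - k * 1)) (by rw [abs_le]; constructor <;> nlinarith)
  have h2 := bound s (by rw [abs_le]; constructor <;> nlinarith)
  have h3 := mul_le_mul_of_nonneg_left h2 (by linarith : (0 : ℝ) ≤ k - 1)
  have h4 := mul_le_mul_of_nonneg_left (Real.add_one_le_exp (s ^ 2 * k)) (by linarith : (0 : ℝ) ≤ k)
  nlinarith [sq_nonneg s]

/-- Chernoff bound: for a uniform coloring, `#T - k * #(T ∩ color i)` is a sum of independent
mean-zero terms, and the event forces it to be at least `η * n`. -/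
theorem card_rare_color_le (h0 : 0 < η) (h1 : η < 1) (hk : 1 ≤ k) (T : Finset (Fin n))
    (i : Fin k) :
    (#(univ.filter fun c : Allocation n k => profile η c T i < density η T) : ℝ) ≤
      k ^ n * Real.exp (-(η ^ 2 / (4 * k)) * n) := by
  have hk1 : (1 : ℝ) ≤ k := by exact_mod_cast hk
  -- This `s` minimizes the exponent `s ^ 2 * k - s * η` per item.
  set s : ℝ := η / (2 * k) with hs
  have hs0 : 0 ≤ s := by positivity
  have hsk : s * k ≤ 1 := by
    have : s * k = η / 2 := by rw [hs]; field_simp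
    linarith
  let w : Fin k → ℝ := fun j => s * (1 - k * if j = i then 1 else 0)
  have hw : ∀ c : Allocation n k, ∑ u ∈ T, w (c u) =
      s * (#T - k * #(T.filter fun u => c u = i)) := fun c => by
    simp only [w, ← mul_sum, sum_sub_distrib, card_filter]
    push_cast
    simp
  have hdev : ∀ c : Allocation n k, profile η c T i < density η T →
      1 ≤ Real.exp (-(s * η * n)) * Real.exp (∑ u ∈ T, w (c u)) := fun c hc => by
    rw [← Real.exp_add, Real.one_le_exp_iff, hw]
    have hn : 0 < n := by
      by_contra hn
      have : n = 0 := by omega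
      subst this
      simp [profile, density] at hc
      linarith
    have hn' : (0 : ℝ) < n := by exact_mod_cast hn
    have h2 : η * n < (1 - η) * (#T - k * #(T.filter fun u => c u = i)) := by
      unfold profile density at hc
      have h3 := mul_lt_mul_of_pos_right hc hn'
      have e1 : (2 * η + (1 - η) * (k / n) * #(T.filter fun u => c u = i)) * n =
          2 * η * n + (1 - η) * (k * #(T.filter fun u => c u = i)) := by field_simp
      have e2 : (η + (1 - η) * (#T / n)) * n = η * n + (1 - η) * #T := by field_simp
      rw [e1, e2] at h3
      linarith
    have h3 : η * n ≤ #T - k * #(T.filter fun u => c u = i) := by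
      have : 0 < η * n := by positivity
      nlinarith
    have h4 := mul_le_mul_of_nonneg_left h3 hs0
    linarith
  have hexp : ∑ c : Allocation n k, Real.exp (∑ u ∈ T, w (c u)) ≤
      (k * Real.exp (s ^ 2 * k)) ^ n := by
    have e : ∀ c : Allocation n k, Real.exp (∑ u ∈ T, w (c u)) =
        ∏ u, if u ∈ T then Real.exp (w (c u)) else 1 := fun c => by
      rw [Real.exp_sum, prod_ite_mem, univ_inter]
    simp only [e]
    have e2 := (prod_univ_sum (fun _ : Fin n => (univ : Finset (Fin k)))
      fun u j => if u ∈ T then Real.exp (w j) else 1).symm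
    rw [Fintype.piFinset_univ] at e2
    rw [e2]
    refine (prod_le_prod (g := fun _ => k * Real.exp (s ^ 2 * k))
      (fun u _ => sum_nonneg fun j _ => ?_) fun u _ => ?_).trans_eq ?_
    · split_ifs
      · exact (Real.exp_pos _).le
      · exact zero_le_one
    · split_ifs
      · exact exp_average_le hk hs0 hsk i
      · simp only [sum_const, card_univ, Fintype.card_fin, nsmul_eq_mul]
        exact mul_le_mul_of_nonneg_left (Real.one_le_exp (by positivity)) (by linarith)
    · rw [prod_const, card_univ, Fintype.card_fin]
  calc (#(univ.filter fun c : Allocation n k => profile η c T i < density η T) : ℝ)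
      = ∑ c ∈ univ.filter (fun c : Allocation n k => profile η c T i < density η T), (1 : ℝ) := by
        simp
    _ ≤ ∑ c ∈ univ.filter (fun c : Allocation n k => profile η c T i < density η T),
          Real.exp (-(s * η * n)) * Real.exp (∑ u ∈ T, w (c u)) :=
        sum_le_sum fun c hc => hdev c (mem_filter.1 hc).2
    _ ≤ ∑ c : Allocation n k, Real.exp (-(s * η * n)) * Real.exp (∑ u ∈ T, w (c u)) :=
        sum_le_sum_of_subset_of_nonneg (filter_subset _ _) fun _ _ _ => by positivity
    _ ≤ Real.exp (-(s * η * n)) * (k * Real.exp (s ^ 2 * k)) ^ n := by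
        rw [← mul_sum]
        exact mul_le_mul_of_nonneg_left hexp (Real.exp_pos _).le
    _ = k ^ n * Real.exp (-(η ^ 2 / (4 * k)) * n) := by
        rw [mul_pow, ← Real.exp_nat_mul, mul_left_comm, ← Real.exp_add]
        congr 2
        rw [hs]
        field_simp
        ring

open Classical in
/-- All but an exponentially small fraction of the colorings are balanced on a given set. -/
theorem card_not_balanced_le (h0 : 0 < η) (h1 : η < 1) (hk : 1 ≤ k) (S : Finset (Fin n)) :
    (#(univ.filter fun c : Allocation n k => ¬ Balanced η c S) : ℝ) ≤
      k * Real.exp (-(η ^ 2 / (4 * k)) * n) * k ^ n := by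
  have hsub : (univ.filter fun c : Allocation n k => ¬ Balanced η c S) ⊆
      (univ : Finset (Fin k)).biUnion fun i =>
        univ.filter fun c : Allocation n k => profile η c Sᶜ i < density η Sᶜ := by
    intro c hc
    simpa [Balanced] using hc
  calc (#(univ.filter fun c : Allocation n k => ¬ Balanced η c S) : ℝ)
      ≤ ∑ i : Fin k, (#(univ.filter fun c : Allocation n k =>
          profile η c Sᶜ i < density η Sᶜ) : ℝ) := by
        exact_mod_cast (card_le_card hsub).trans card_biUnion_le
    _ ≤ ∑ _i : Fin k, (k : ℝ) ^ n * Real.exp (-(η ^ 2 / (4 * k)) * n) :=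
        sum_le_sum fun i _ => card_rare_color_le h0 h1 hk _ i
    _ = _ := by
        rw [sum_const, card_univ, Fintype.card_fin, nsmul_eq_mul]; ring

end Instances

end
end SubmodularWelfare

/-! ### Indistinguishability: algorithms that rarely query a separating set. -/

namespace SubmodularWelfare
noncomputable section
open Finset
open scoped ENNReal

namespace OracleAlgorithm

variable {n k : ℕ} (A : OracleAlgorithm n k)

/-- The expected welfare of a solution that is produced within `t` steps from a given state. -/
def welfareWithin (f : Finset (Fin n) → ℝ) (t : ℕ) (s : A.State) : ℝ≥0∞ :=
  ∑ a : Allocation n k, A.run f t s (some a) * ENNReal.ofReal (welfare f a)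

open Classical in
/-- The expected number of queries outside a family `𝒢` of sets in the first `t` steps from a
given state, where a solution with a part outside `𝒢` counts as one more such query. -/
def missesWithin (g : Finset (Fin n) → ℝ) (𝒢 : Set (Finset (Fin n))) : ℕ → A.State → ℝ≥0∞
  | 0, _ => 0
  | t + 1, s =>
    match A.act s with
    | .output a => if ∀ i, part a i ∈ 𝒢 then 0 else 1
    | .query S next => (if S ∈ 𝒢 then 0 else 1) + missesWithin g 𝒢 t (next (g S))
    | .internal p => ∑' s', p s' * missesWithin g 𝒢 t s'

variable {A}

theorem welfareWithin_output {f : Finset (Fin n) → ℝ} {s : A.State} {a : Allocation n k}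
    (h : A.act s = .output a) (t : ℕ) :
    A.welfareWithin f (t + 1) s = ENNReal.ofReal (welfare f a) := by
  rw [welfareWithin, run_output f h, sum_eq_single a]
  · simp
  · intro b _ hb
    simp [hb]
  · simp

theorem welfareWithin_query {f : Finset (Fin n) → ℝ} {s : A.State} {S : Finset (Fin n)}
    {next : ℝ → A.State} (h : A.act s = .query S next) (t : ℕ) :
    A.welfareWithin f (t + 1) s = A.welfareWithin f t (next (f S)) := by
  rw [welfareWithin, run_query f h, welfareWithin]

theorem welfareWithin_internal {f : Finset (Fin n) → ℝ} {s : A.State} {p : PMF A.State}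
    (h : A.act s = .internal p) (t : ℕ) :
    A.welfareWithin f (t + 1) s = ∑' s', p s' * A.welfareWithin f t s' := by
  simp only [welfareWithin, run_internal f h, PMF.bind_apply, mul_sum]
  rw [Summable.tsum_finsetSum fun _ _ => ENNReal.summable]
  refine sum_congr rfl fun a _ => ?_
  rw [← ENNReal.tsum_mul_right]
  exact tsum_congr fun s' => mul_assoc _ _ _

theorem tsum_weight_mul_le (p : PMF A.State) {F G : A.State → ℝ≥0∞} (h : ∀ s, F s ≤ G s) :
    ∑' s, p s * F s ≤ ∑' s, p s * G s :=
  ENNReal.tsum_le_tsum fun s => mul_le_mul_right (h s) _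

theorem tsum_weight_mul_affine (p : PMF A.State) (b c : ℝ≥0∞) (F : A.State → ℝ≥0∞) :
    ∑' s, p s * (b + c * F s) = b + c * ∑' s, p s * F s := by
  simp only [mul_add, mul_left_comm _ c]
  rw [ENNReal.tsum_add, ENNReal.tsum_mul_right, p.tsum_coe, one_mul, ENNReal.tsum_mul_left]

theorem welfareWithin_le {f : Finset (Fin n) → ℝ} {K : ℝ}
    (hK : ∀ a : Allocation n k, welfare f a ≤ K)
    (t : ℕ) (s : A.State) : A.welfareWithin f t s ≤ ENNReal.ofReal K := by
  calc A.welfareWithin f t s ≤ ∑ a : Allocation n k, A.run f t s (some a) * ENNReal.ofReal K :=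
        sum_le_sum fun a _ => mul_le_mul_right (ENNReal.ofReal_le_ofReal (hK a)) _
    _ = (∑ a : Allocation n k, A.run f t s (some a)) * ENNReal.ofReal K := (sum_mul _ _ _).symm
    _ ≤ 1 * ENNReal.ofReal K := by
        refine mul_le_mul_left ?_ _
        have h := (A.run f t s).tsum_coe
        rw [tsum_fintype, Fintype.sum_option] at h
        exact h ▸ le_add_self
    _ = ENNReal.ofReal K := one_mul _

/-- An algorithm cannot tell two functions apart that agree on the family `𝒢`, unless it makes a
query outside `𝒢`. -/
theorem welfareWithin_le_of_eqOn {f g : Finset (Fin n) → ℝ} {𝒢 : Set (Finset (Fin n))}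
    (hfg : ∀ S ∈ 𝒢, f S = g S) {K β : ℝ} (hK : ∀ a : Allocation n k, welfare f a ≤ K)
    (hβ : ∀ a : Allocation n k, welfare g a ≤ β) (t : ℕ) (s : A.State) :
    A.welfareWithin f t s ≤ ENNReal.ofReal β + ENNReal.ofReal K * A.missesWithin g 𝒢 t s := by
  induction t generalizing s with
  | zero => simp [welfareWithin, run]
  | succ t ih =>
    cases h : A.act s with
    | output a =>
      rw [missesWithin, h]
      dsimp only
      split_ifs with ha
      · rw [welfareWithin_output h, mul_zero, add_zero]
        refine ENNReal.ofReal_le_ofReal (le_trans (le_of_eq ?_) (hβ a))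
        exact sum_congr rfl fun i _ => hfg _ (ha i)
      · rw [mul_one]
        exact (welfareWithin_le hK _ _).trans le_add_self
    | query S next =>
      rw [missesWithin, h]
      dsimp only
      split_ifs with hS
      -- Both functions give the same answer, so the runs continue from the same state; after a
      -- miss, the single term `K` pays for everything that follows.
      · rw [welfareWithin_query h, hfg S hS, zero_add]
        exact ih _
      · rw [mul_add, mul_one]
        exact (welfareWithin_le hK _ _).trans (le_self_add.trans le_add_self)
    | internal p =>
      rw [missesWithin, h, welfareWithin_internal h]
      dsimp only
      rw [← tsum_weight_mul_affine]
      exact tsum_weight_mul_le p ih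

open Classical in
/-- If every set lies outside few members of a collection of families, then so do the queries of an
algorithm, in expectation. -/
theorem sum_missesWithin_le {ι : Type*} [Fintype ι] (g : Finset (Fin n) → ℝ)
    (𝒢 : ι → Set (Finset (Fin n))) {τ : ℝ≥0∞}
    (hτ : ∀ S, ∑ c, (if S ∈ 𝒢 c then 0 else 1) ≤ τ) (t : ℕ) (s : A.State) :
    ∑ c, A.missesWithin g (𝒢 c) t s ≤ τ * k + τ * A.expectedQueriesWithin g t s := by
  induction t generalizing s with
  | zero => simp [missesWithin]
  | succ t ih =>
    simp only [missesWithin, expectedQueriesWithin]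
    cases h : A.act s with
    | output a =>
      dsimp only
      -- Union bound over the `k` parts of the solution, which accounts for the term `τ * k`. The
      -- run on `g` does not depend on `c`, so the sum over `c` can be taken at every step.
      have h1 : ∀ c, (if ∀ i, part a i ∈ 𝒢 c then (0 : ℝ≥0∞) else 1) ≤
          ∑ i, if part a i ∈ 𝒢 c then 0 else 1 := fun c => by
        split_ifs with hc
        · exact zero_le
        · push Not at hc
          obtain ⟨i, hi⟩ := hc
          refine le_trans ?_ (single_le_sum (fun _ _ => zero_le) (mem_univ i))
          rw [if_neg hi]
      calc ∑ c, (if ∀ i, part a i ∈ 𝒢 c then (0 : ℝ≥0∞) else 1)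
          ≤ ∑ c, ∑ i, (if part a i ∈ 𝒢 c then (0 : ℝ≥0∞) else 1) := sum_le_sum fun c _ => h1 c
        _ = ∑ i, ∑ c, (if part a i ∈ 𝒢 c then (0 : ℝ≥0∞) else 1) := sum_comm
        _ ≤ ∑ _i : Fin k, τ := sum_le_sum fun i _ => hτ _
        _ = τ * k + τ * 0 := by simp [mul_comm]
    | query S next =>
      dsimp only
      rw [sum_add_distrib, mul_add, mul_one, add_left_comm]
      exact add_le_add (hτ S) (ih _)
    | internal p =>
      dsimp only
      rw [← Summable.tsum_finsetSum fun _ _ => ENNReal.summable, ← tsum_weight_mul_affine]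
      simp only [← mul_sum]
      exact tsum_weight_mul_le p ih

variable (A)

theorem welfareWithin_mono (f : Finset (Fin n) → ℝ) (s : A.State) :
    Monotone fun t => A.welfareWithin f t s := fun _ _ h =>
  sum_le_sum fun a _ => mul_le_mul_left (A.run_some_mono f a s h) _

theorem ofReal_expectedWelfare {f : Finset (Fin n) → ℝ} (hf : IsUtility f) :
    ENNReal.ofReal (A.expectedWelfare f) = ⨆ t, A.welfareWithin f t A.start := by
  have hw : ∀ a : Allocation n k, 0 ≤ welfare f a := fun a => sum_nonneg fun _ _ => hf.nonneg _
  have hp : ∀ a : Allocation n k, A.outputProb f a ≠ ⊤ := fun a =>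
    ((iSup_le fun t => PMF.coe_le_one _ _).trans_lt ENNReal.one_lt_top).ne
  unfold welfareWithin expectedWelfare
  rw [ENNReal.ofReal_sum_of_nonneg fun a _ => mul_nonneg ENNReal.toReal_nonneg (hw a),
    ← ENNReal.finsetSum_iSup_of_monotone]
  · refine sum_congr rfl fun a _ => ?_
    rw [ENNReal.ofReal_mul ENNReal.toReal_nonneg, ENNReal.ofReal_toReal (hp a), outputProb,
      ENNReal.iSup_mul]
  · exact fun a _ _ h => mul_le_mul_left (A.run_some_mono f a _ h) _

open Classical in
/-- The total expected welfare on a collection of instances `f c` each of which looks like `g` on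
a family `𝒢 c` of sets. -/
theorem sum_expectedWelfare_le {ι : Type*} [Fintype ι] {f : ι → Finset (Fin n) → ℝ}
    {g : Finset (Fin n) → ℝ} {𝒢 : ι → Set (Finset (Fin n))} (hf : ∀ c, IsUtility (f c))
    (hfg : ∀ c, ∀ S ∈ 𝒢 c, f c S = g S) {K β : ℝ}
    (hK : ∀ c, ∀ a : Allocation n k, welfare (f c) a ≤ K)
    (hβ : ∀ a : Allocation n k, welfare g a ≤ β) {τ : ℝ≥0∞}
    (hτ : ∀ S, ∑ c, (if S ∈ 𝒢 c then 0 else 1) ≤ τ) :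
    ∑ c, ENNReal.ofReal (A.expectedWelfare (f c)) ≤
      Fintype.card ι * ENNReal.ofReal β +
        ENNReal.ofReal K * (τ * k + τ * A.expectedQueries g) := by
  simp only [A.ofReal_expectedWelfare (hf _)]
  rw [ENNReal.finsetSum_iSup_of_monotone fun c => A.welfareWithin_mono (f c) A.start]
  refine iSup_le fun t => ?_
  calc ∑ c, A.welfareWithin (f c) t A.start
      ≤ ∑ c, (ENNReal.ofReal β + ENNReal.ofReal K * A.missesWithin g (𝒢 c) t A.start) :=
        sum_le_sum fun c _ => welfareWithin_le_of_eqOn (hfg c) (hK c) hβ t _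
    _ = Fintype.card ι * ENNReal.ofReal β +
          ENNReal.ofReal K * ∑ c, A.missesWithin g (𝒢 c) t A.start := by
        rw [sum_add_distrib, ← mul_sum]; simp
    _ ≤ _ := by
        gcongr
        refine (sum_missesWithin_le g 𝒢 hτ t _).trans ?_
        gcongr
        exact le_iSup (fun t => A.expectedQueriesWithin g t A.start) t

end OracleAlgorithm

end
end SubmodularWelfare

/-! ### The exponential lower bound on the number of queries. -/

namespace SubmodularWelfare
noncomputable section
open Finset
open scoped ENNReal

section Hardness

variable {n k : ℕ}

/-- The advantage `ε * (k - 1) ≥ ε` pays for `ε / 2` and for all errors of order `η`; `D` is chosen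
so that these errors total at most `ε / 2`. -/
theorem ratio_gap {r ε : ℝ} (hr1 : r ≤ 1) (hε : 0 < ε) (hk : 2 ≤ k) :
    ∃ η : ℝ, 0 < η ∧ η < 1 ∧
      (k - 1) * r + η + ε / 2 ≤ (r + ε) * ((k : ℝ) - 1 - 2 * η * k ^ k) := by
  have hk2 : (2 : ℝ) ≤ k := by exact_mod_cast hk
  set D : ℝ := 2 * (1 + (1 + ε) * (2 * k ^ k)) with hD
  have hD0 : 0 < D := by positivity
  refine ⟨min (1 / 2) (ε / D), by positivity, by
    linarith [min_le_left (1 / 2 : ℝ) (ε / D)], ?_⟩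
  set η := min (1 / 2) (ε / D)
  have hη0 : 0 < η := by positivity
  have h1 : η * D ≤ ε := (le_div_iff₀ hD0).1 (min_le_right _ _)
  have h2 : (r + ε) * (2 * η * k ^ k) ≤ (1 + ε) * (2 * η * k ^ k) := by gcongr
  have h3 : ε ≤ ε * (k - 1) := le_mul_of_one_le_right hε.le (by linarith)
  rw [hD] at h1
  linarith

-- On each hidden instance the ratio forces welfare at least `β + ε / 2`, while without a miss only
-- `β` is achievable. The factor `k ^ 2` is the welfare bound `k` times the union bound over `k`
-- colors; the summand `k` counts the parts of the solution.
open Classical in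
theorem averaged_gap {η ε r : ℝ} (h0 : 0 < η) (h1 : η < 1) (hn : 0 < n) (hk : 2 ≤ k)
    (hr : r = 1 - (1 - 1 / (k : ℝ)) ^ (k - 1)) (hr0 : 0 ≤ r) (hε : 0 < ε)
    (hgap : (k - 1) * r + η + ε / 2 ≤ (r + ε) * ((k : ℝ) - 1 - 2 * η * k ^ k))
    {A : OracleAlgorithm n k} (hA : A.HasRatio (r + ε))
    (hQ : A.expectedQueries (symmetric k η) ≠ ⊤) :
    ε / 2 ≤ k ^ 2 * Real.exp (-(η ^ 2 / (4 * k)) * n) *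
      (k + (A.expectedQueries (symmetric k η)).toReal) := by
  have hk1 : 1 ≤ k := by omega
  have hk2 : (2 : ℝ) ≤ k := by exact_mod_cast hk
  set q := (A.expectedQueries (symmetric k η)).toReal with hq
  have hq0 : 0 ≤ q := ENNReal.toReal_nonneg
  set β : ℝ := (k - 1) * r + η with hβ
  have hβ0 : 0 ≤ β := add_nonneg (mul_nonneg (by linarith) hr0) h0.le
  set τ : ℝ := k * Real.exp (-(η ^ 2 / (4 * k)) * n) * k ^ n with hτ
  have hτ0 : 0 ≤ τ := by positivity
  have hlow : ∀ c : Allocation n k, β + ε / 2 ≤ A.expectedWelfare (hidden η c) := fun c => by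
    refine hgap.trans (le_trans ?_ (hA _ (hidden_isUtility h0 h1.le hk1 c)))
    exact mul_le_mul_of_nonneg_left
      ((welfare_hidden_ge h0 h1.le hn hk1 c).trans (welfare_le_opt _ c)) (by linarith)
  have hup := A.sum_expectedWelfare_le (f := fun c : Allocation n k => hidden η c)
    (g := symmetric k η) (𝒢 := fun c => {S | Balanced η c S}) (K := k) (β := β)
    (τ := ENNReal.ofReal τ) (hidden_isUtility h0 h1.le hk1)
    (fun c S hS => hidden_eq_symmetric h0 h1.le hk1 hS)
    (fun c a => (sum_le_sum fun i _ => hidden_le_one h0 h1.le hk1 c (part a i)).trans_eq (by simp))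
    (fun a => by rw [hβ, hr]; exact welfare_symmetric_le h0 h1.le hn hk a)
    (fun S => by
      have h2 := ENNReal.ofReal_le_ofReal (card_not_balanced_le h0 h1 hk1 S)
      rw [ENNReal.ofReal_natCast] at h2
      refine le_trans (le_of_eq ?_) h2
      rw [card_filter, Nat.cast_sum]
      refine sum_congr rfl fun c _ => ?_
      simp only [Set.mem_ofPred_eq]
      split_ifs <;> simp_all)
  rw [← ENNReal.ofReal_toReal hQ, ← hq, Fintype.card_fun, Fintype.card_fin, Fintype.card_fin,
    ← ENNReal.ofReal_natCast, ← ENNReal.ofReal_natCast k, ← ENNReal.ofReal_mul hτ0,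
    ← ENNReal.ofReal_mul hτ0, ← ENNReal.ofReal_add (by positivity) (by positivity),
    ← ENNReal.ofReal_mul (by positivity), ← ENNReal.ofReal_mul (by positivity),
    ← ENNReal.ofReal_add (by positivity) (by positivity)] at hup
  have hsum : ENNReal.ofReal ((k : ℝ) ^ n * (β + ε / 2)) ≤
      ∑ c : Allocation n k, ENNReal.ofReal (A.expectedWelfare (hidden η c)) := by
    refine le_trans (le_of_eq ?_) (sum_le_sum fun c _ => ENNReal.ofReal_le_ofReal (hlow c))
    rw [sum_const, card_univ, Fintype.card_fun, Fintype.card_fin, Fintype.card_fin, nsmul_eq_mul,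
      ← ENNReal.ofReal_natCast, ← ENNReal.ofReal_mul (by positivity), Nat.cast_pow]
  have hfin := (ENNReal.ofReal_le_ofReal_iff (by positivity)).1 (hsum.trans hup)
  rw [Nat.cast_pow] at hfin
  have hkn : (0 : ℝ) < (k : ℝ) ^ n := by positivity
  refine le_of_mul_le_mul_left ?_ hkn
  rw [hτ] at hfin
  linarith

theorem exponential_queries (hk : 2 ≤ k) {ε : ℝ} (hε : 0 < ε) :
    ∃ c : ℝ, 0 < c ∧ ∃ n₀ : ℕ, ∀ n : ℕ, n₀ ≤ n → ∀ A : OracleAlgorithm n k,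
      A.HasRatio (1 - (1 - 1 / (k : ℝ)) ^ (k - 1) + ε) →
      ∃ f : Finset (Fin n) → ℝ, IsUtility f ∧
        ENNReal.ofReal (Real.exp (c * n)) ≤ A.expectedQueries f := by
  have hk2 : (2 : ℝ) ≤ k := by exact_mod_cast hk
  have hp0 : (0 : ℝ) ≤ 1 - 1 / k := by
    rw [sub_nonneg, div_le_one (by linarith)]; linarith
  have hp1 : 1 - 1 / (k : ℝ) ≤ 1 := sub_le_self _ (by positivity)
  have hr0 : 0 ≤ 1 - (1 - 1 / (k : ℝ)) ^ (k - 1) := sub_nonneg.2 (pow_le_one₀ hp0 hp1)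
  have hr1 : 1 - (1 - 1 / (k : ℝ)) ^ (k - 1) ≤ 1 := sub_le_self _ (pow_nonneg hp0 _)
  obtain ⟨η, h0, h1, hgap⟩ := ratio_gap hr1 hε hk
  -- Half the Chernoff exponent: the failure probability becomes `E⁻²` up to constants, and one
  -- factor `E = exp (c * n)` absorbs all constants once `E ≥ B`.
  set c : ℝ := η ^ 2 / (8 * k) with hc
  have hc0 : 0 < c := by positivity
  set B : ℝ := (1 + k) * (2 * k ^ 2) / ε with hB
  -- The summand `1` ensures `n > 0`.
  refine ⟨c, hc0, ⌈B / c⌉₊ + 1, fun n hn A hA => ⟨symmetric k η,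
    symmetric_isUtility h0 h1.le (by omega), ?_⟩⟩
  by_cases hQ : A.expectedQueries (symmetric k η) = ⊤
  · rw [hQ]; exact le_top
  rw [← ENNReal.ofReal_toReal hQ]
  refine ENNReal.ofReal_le_ofReal ?_
  have key := averaged_gap h0 h1 (by omega) hk rfl hr0 hε hgap hA hQ
  set q := (A.expectedQueries (symmetric k η)).toReal
  have hBn : B ≤ Real.exp (c * n) := by
    have h2 : B / c ≤ n := (Nat.le_ceil _).trans (by exact_mod_cast (by omega))
    rw [div_le_iff₀ hc0] at h2
    linarith [Real.add_one_le_exp (c * n)]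
  set E := Real.exp (c * n) with hE
  have hE1 : 1 ≤ E := Real.one_le_exp (by positivity)
  have hexp : Real.exp (-(η ^ 2 / (4 * k)) * n) = (E * E)⁻¹ := by
    rw [hE, ← Real.exp_add, ← Real.exp_neg, hc]
    congr 1
    field_simp
    ring
  rw [hexp, mul_right_comm, ← div_eq_mul_inv, le_div_iff₀ (by positivity)] at key
  have hBE : (1 + k) * (2 * k ^ 2) ≤ E * ε := (div_le_iff₀ hε).1 hBn
  have h3 : (1 + k) * E ≤ k + q := by
    have h4 := mul_le_mul_of_nonneg_right hBE (by linarith : (0 : ℝ) ≤ E)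
    refine le_of_mul_le_mul_left ?_ (by positivity : (0 : ℝ) < k ^ 2)
    linarith
  have h5 : (k : ℝ) ≤ k * E := le_mul_of_one_le_right (by linarith) hE1
  linarith

end Hardness

end
end SubmodularWelfare

theorem theorem6 :
    -- one program that, for all `n` and `k`, runs in time linear in `n`, assigns every item
    -- independently to a uniformly random player, and has the claimed approximation ratio
    (∃ (P : Program) (C : ℕ), ∀ (n k : ℕ), 1 ≤ k →
      (∀ f : Finset (Fin n) → ℝ, IsUtility f →
        (P.algorithm n k).HaltsWithin f (C * (n + 1)) ∧
        ∀ a : Allocation n k, (P.algorithm n k).outputProb f a = ((k : ENNReal) ^ n)⁻¹) ∧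
      (P.algorithm n k).HasRatio (1 - (1 - 1 / (k : ℝ)) ^ (k - 1))) ∧
    -- every algorithm with a better ratio makes exponentially many oracle queries
    (∀ k : ℕ, 2 ≤ k → ∀ ε : ℝ, 0 < ε →
      ∃ c : ℝ, 0 < c ∧ ∃ n₀ : ℕ, ∀ n : ℕ, n₀ ≤ n → ∀ A : OracleAlgorithm n k,
        A.HasRatio (1 - (1 - 1 / (k : ℝ)) ^ (k - 1) + ε) →
        ∃ f : Finset (Fin n) → ℝ, IsUtility f ∧
          ENNReal.ofReal (Real.exp (c * n)) ≤ A.expectedQueries f) :=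
  ⟨⟨randomProgram, 6, fun _ _ hk => ⟨fun f _ => ⟨randomProgram_haltsWithin hk f,
    randomProgram_outputProb hk f⟩, randomProgram_hasRatio hk⟩⟩,
    fun _ hk _ hε => exponential_queries hk hε⟩
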